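/- For positive integers $d$ and $n$, the $d$-process on $n$ vertices is the following random process. Start with the empty graph on the vertex set $\{1,\dots,n\}$. At each step, as long as possible, choose a pair of distinct vertices uniformly at random from all pairs that are not edges of the current graph and whose two vertices both have current degree less than $d$, and add this pair as an edge. The process stops after at most $\lfloor dn/2\rfloor$ steps, when no such pair exists; the graph obtained is called the final graph. **Theorem.** For every fixed integer $d\ge 2$, the probability that the final graph of the $d$-process on $n$ vertices either is $d$-regular, or has exactly one vertex of degree $d-1$ and all other vertices of degree $d$, tends to $1$ as $n\to\infty$. -/

import Mathlib

open Filter Topology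

namespace RandomDGraph

noncomputable section

open scoped Classical in
/-- The pairs of distinct vertices that are not edges of `G` and whose two endpoints are both
unsaturated, i.e. have current degree less than `d`. -/
def addable {n : ℕ} (d : ℕ) (G : SimpleGraph (Fin n)) : Finset (Sym2 (Fin n)) :=
  Finset.univ.filter fun e => ¬ e.IsDiag ∧ e ∉ G.edgeSet ∧ ∀ v ∈ e, G.degree v < d

/-- The graph `G` with the pair `e` added as an edge. -/
def addEdge {n : ℕ} (G : SimpleGraph (Fin n)) (e : Sym2 (Fin n)) : SimpleGraph (Fin n) :=
  G ⊔ SimpleGraph.fromEdgeSet {e}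

open scoped Classical in
/-- One step of the `d`-process: add a uniformly random addable pair as an edge. When there is no
addable pair, the process is stuck and the graph stays as it is. -/
def step {n : ℕ} (d : ℕ) (G : SimpleGraph (Fin n)) : PMF (SimpleGraph (Fin n)) :=
  if h : (addable d G).Nonempty then
    (PMF.uniformOfFinset (addable d G) h).map (addEdge G)
  else PMF.pure G

/-- The law of the graph of the `d`-process on `n` vertices after `s` steps, started from the
empty graph. -/
def law (d n : ℕ) : ℕ → PMF (SimpleGraph (Fin n))
  | 0 => PMF.pure ⊥
  | s + 1 => (law d n s).bind (step d)

/-- The law of the final graph of the `d`-process on `n` vertices. The process is stuck after at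
most `⌊dn/2⌋` steps, see `addable_eq_empty_of_mem_support_final`. -/
def final (d n : ℕ) : PMF (SimpleGraph (Fin n)) := law d n (d * n / 2)

open scoped Classical in
/-- `G` is `d`-regular, or one vertex has degree `d - 1` and all the others have degree `d`. -/
def IsSaturated {n : ℕ} (d : ℕ) (G : SimpleGraph (Fin n)) : Prop :=
  G.IsRegularOfDegree d ∨
    ∃ v, G.degree v = d - 1 ∧ ∀ w, w ≠ v → G.degree w = d

/-- The probability that the `d`-process on `n` vertices saturates. -/
def probSaturates (d n : ℕ) : ENNReal :=
  (final d n).toOuterMeasure {G | IsSaturated d G}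

end

open scoped Classical in
theorem addEdge_degree_card {n d : ℕ} {G : SimpleGraph (Fin n)} {e : Sym2 (Fin n)}
    (he : e ∈ addable d G) (hd : ∀ v, G.degree v ≤ d) :
    (∀ v, (addEdge G e).degree v ≤ d) ∧
      (addEdge G e).edgeFinset.card = G.edgeFinset.card + 1 := by
  simp only [addable, Finset.mem_filter, Finset.mem_univ, true_and] at he
  obtain ⟨h1, h2, h3⟩ := he
  have hE : (addEdge G e).edgeFinset = insert e G.edgeFinset := by
    ext x
    have hx : x ∈ (addEdge G e).edgeSet ↔ x = e ∨ x ∈ G.edgeSet := by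
      simp only [addEdge, SimpleGraph.edgeSet_sup, SimpleGraph.edgeSet_fromEdgeSet, Set.mem_union,
        Set.mem_sdiff, Set.mem_singleton_iff]
      constructor
      · rintro (h | ⟨h, -⟩)
        · exact Or.inr h
        · exact Or.inl h
      · rintro (rfl | h)
        · exact Or.inr ⟨rfl, h1⟩
        · exact Or.inl h
    rw [SimpleGraph.mem_edgeFinset, hx, Finset.mem_insert, SimpleGraph.mem_edgeFinset]
  refine ⟨fun v => ?_, ?_⟩
  · rw [← SimpleGraph.card_incidenceFinset_eq_degree, SimpleGraph.incidenceFinset_eq_filter, hE,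
      Finset.filter_insert]
    have hG : (G.edgeFinset.filter (fun x => v ∈ x)).card = G.degree v := by
      rw [← SimpleGraph.incidenceFinset_eq_filter, SimpleGraph.card_incidenceFinset_eq_degree]
    split_ifs with hv
    · have := h3 v hv
      have := Finset.card_insert_le e (G.edgeFinset.filter (fun x => v ∈ x))
      omega
    · rw [hG]; exact hd v
  · rw [hE, Finset.card_insert_of_notMem]
    simpa using h2

open scoped Classical in
theorem law_invariant (d n s : ℕ) : ∀ G ∈ (law d n s).support,
    (∀ v, G.degree v ≤ d) ∧ (addable d G = ∅ ∨ G.edgeFinset.card = s) := by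
  induction s with
  | zero =>
    intro G hG
    simp only [law, PMF.support_pure, Set.mem_singleton_iff] at hG
    subst hG
    simp
  | succ s ih =>
    intro G hG
    simp only [law, PMF.mem_support_bind_iff] at hG
    obtain ⟨H, hH, hG⟩ := hG
    obtain ⟨hd, hs⟩ := ih H hH
    unfold step at hG
    split_ifs at hG with hne
    · simp only [PMF.mem_support_map_iff, PMF.mem_support_uniformOfFinset_iff] at hG
      obtain ⟨e, he, rfl⟩ := hG
      have h := addEdge_degree_card he hd
      refine ⟨h.1, Or.inr ?_⟩
      rcases hs with hs | hs
      · simp [hs] at hne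
      · rw [h.2, hs]
    · simp only [PMF.support_pure, Set.mem_singleton_iff] at hG
      subst hG
      exact ⟨hd, Or.inl (Finset.not_nonempty_iff_eq_empty.mp hne)⟩

/-- After `⌊dn/2⌋` steps, no further edge can be added. -/
theorem addable_eq_empty_of_mem_support_final (d n : ℕ) :
    ∀ G ∈ (final d n).support, addable d G = ∅ := by
  classical
  intro G hG
  obtain ⟨hd, h | h⟩ := law_invariant d n (d * n / 2) G hG
  · exact h
  · by_contra hne
    obtain ⟨e, he⟩ := Finset.nonempty_iff_ne_empty.mpr hne
    obtain ⟨h1, h2⟩ := addEdge_degree_card he hd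
    have h3 := (addEdge G e).sum_degrees_eq_twice_card_edges
    have h4 : ∑ v, (addEdge G e).degree v ≤ ∑ _v : Fin n, d := Finset.sum_le_sum fun v _ => h1 v
    simp only [Finset.sum_const, Finset.card_univ, Fintype.card_fin, smul_eq_mul] at h4
    have h5 : n * d = d * n := Nat.mul_comm n d
    have h6 : (addEdge G e).edgeFinset.card = d * n / 2 + 1 := by rw [h2]; convert congrArg (· + 1) h
    have h7 : ∑ v, (addEdge G e).degree v = 2 * (d * n / 2 + 1) := by
      rw [← h6]; convert h3
    omega

end RandomDGraph

/-! Measure time by r, the number of steps remaining out of ⌊dn/2⌋. Unless the process is stuck,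
which cannot happen while the deficiency D = Σ (d − deg v) exceeds d², D equals 2r plus the parity
of dn. Two things obstruct saturation: vertices with at least two missing edges, and adjacent pairs
of vertices of degree d − 1. A graph with neither (`IsGood`) keeps this property under further
steps. Once stuck it has at most one unsaturated vertex, because two of them would form an addable
pair. So it suffices that both obstructions vanish in probability at one fixed r. There D is
bounded, and a Markov bound reduces this to showing that the means of the two counts divided by D
tend to 0 as n → ∞.

Let z_k be the number of vertices of degree at most d − k, divided by D. Nearly all pairs of
unsaturated vertices are addable, and one step changes z_k in mean by at most (2/D)(−z_2 z_k + 2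
z_{k+1}) + O(1/D²), with z_{d+1} = 0 (`stepMean_frac_le`). The damping is only quadratic, so the
argument has three stages.

For the powers z_{d−j}^(2^j), the damping term at level j controls the source term at level j + 1.
Telescoping and the divergence of Σ 1/r then give E z_2^P ≤ C/L when L steps remain, with P =
2^(d−2) and n large (`exists_remMean_pow_add_sum_le`, `exists_eventually_remMean_pow_le`).

From L down to a fixed r, a weighted sum of the E z_k grows by a factor of at most (L/r)^(1/(2P)).
This is beaten by the starting size of order L^(−1/P), so L → ∞ gives E z_2 → 0
(`mul_weightedMean_pow_le`, `tendsto_remMean_remFrac`).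

Finally, the mean number of critical pairs over D contracts by 1 − 1/(3r) at each step, up to a
source proportional to E z_2, and the product of these factors tends to 0
(`tendsto_remMean_remCritical`). -/

namespace RandomDGraph

open scoped Classical

/-! ### Counting addable pairs, and the effect of adding one edge. -/

section

/-- The vertices whose degree is at most `d - k`. -/
noncomputable def deficient {n : ℕ} (d k : ℕ) (G : SimpleGraph (Fin n)) : Finset (Fin n) :=
  Finset.univ.filter fun v => G.degree v + k ≤ d

/-- The total number of missing edge endpoints. -/
noncomputable def deficiency {n : ℕ} (d : ℕ) (G : SimpleGraph (Fin n)) : ℕ :=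
  ∑ v, (d - G.degree v)

/-- The ordered pairs of adjacent vertices that both have degree `d - 1`. -/
noncomputable def criticalPairs {n : ℕ} (d : ℕ) (G : SimpleGraph (Fin n)) :
    Finset (Fin n × Fin n) :=
  Finset.univ.filter fun p => G.Adj p.1 p.2 ∧ G.degree p.1 + 1 = d ∧ G.degree p.2 + 1 = d

/-- The addable pairs that contain `v`. -/
noncomputable def addableAt {n : ℕ} (d : ℕ) (G : SimpleGraph (Fin n)) (v : Fin n) :
    Finset (Sym2 (Fin n)) :=
  (addable d G).filter fun e => v ∈ e

/-- The mean of `f` after adding a uniformly random addable pair. -/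
noncomputable def stepMean {n : ℕ} (d : ℕ) (f : SimpleGraph (Fin n) → ℝ)
    (G : SimpleGraph (Fin n)) : ℝ :=
  (∑ e ∈ addable d G, f (addEdge G e)) / (addable d G).card

variable {n d k : ℕ} {G : SimpleGraph (Fin n)} {e : Sym2 (Fin n)} {v w : Fin n}

theorem mem_deficient : v ∈ deficient d k G ↔ G.degree v + k ≤ d := by
  simp [deficient]

theorem mem_addable :
    e ∈ addable d G ↔ ¬ e.IsDiag ∧ e ∉ G.edgeSet ∧ ∀ v ∈ e, G.degree v < d := by
  simp [addable]

theorem addEdge_adj (he : e ∈ addable d G) :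
    (addEdge G e).Adj v w ↔ G.Adj v w ∨ s(v, w) = e := by
  have h1 := (mem_addable.1 he).1
  simp only [addEdge, SimpleGraph.sup_adj, SimpleGraph.fromEdgeSet_adj, Set.mem_singleton_iff]
  constructor
  · rintro (h | ⟨h, -⟩)
    · exact Or.inl h
    · exact Or.inr h
  · rintro (h | rfl)
    · exact Or.inl h
    · exact Or.inr ⟨rfl, by simpa using h1⟩

theorem edgeFinset_addEdge (he : e ∈ addable d G) :
    (addEdge G e).edgeFinset = insert e G.edgeFinset := by
  ext x
  induction x with | _ x y =>
  rw [Finset.mem_insert, SimpleGraph.mem_edgeFinset, SimpleGraph.mem_edgeFinset,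
    SimpleGraph.mem_edgeSet, SimpleGraph.mem_edgeSet, addEdge_adj he, or_comm]

theorem card_filter_mem_edgeFinset (G : SimpleGraph (Fin n)) (v : Fin n) :
    (G.edgeFinset.filter (fun x => v ∈ x)).card = G.degree v := by
  rw [← SimpleGraph.incidenceFinset_eq_filter, SimpleGraph.card_incidenceFinset_eq_degree]

theorem degree_addEdge (he : e ∈ addable d G) (v : Fin n) :
    (addEdge G e).degree v = G.degree v + if v ∈ e then 1 else 0 := by
  rw [← card_filter_mem_edgeFinset, ← card_filter_mem_edgeFinset, edgeFinset_addEdge he,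
    Finset.filter_insert]
  have h := (mem_addable.1 he).2.1
  split_ifs with hv
  · rw [Finset.card_insert_of_notMem]
    simp [h]
  · simp

theorem deficiency_add_two_mul_card (hdeg : ∀ v, G.degree v ≤ d) :
    deficiency d G + 2 * G.edgeFinset.card = d * n := by
  rw [← SimpleGraph.sum_degrees_eq_twice_card_edges, deficiency, ← Finset.sum_add_distrib]
  rw [Finset.sum_congr rfl (fun v _ => Nat.sub_add_cancel (hdeg v))]
  simp [Nat.mul_comm]

theorem deficiency_le : deficiency d G ≤ d * (deficient d 1 G).card := by
  rw [deficient, Finset.card_filter, Finset.mul_sum, deficiency]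
  refine Finset.sum_le_sum fun v _ => ?_
  split_ifs <;> omega

/-- A vertex of degree at most d − 2 contributes at least 2 to the deficiency. This surplus is the
origin of the damping term −z_2 z_k. -/
theorem card_add_card_le_deficiency :
    (deficient d 1 G).card + (deficient d 2 G).card ≤ deficiency d G := by
  rw [deficient, deficient, Finset.card_filter, Finset.card_filter, ← Finset.sum_add_distrib,
    deficiency]
  refine Finset.sum_le_sum fun v _ => ?_
  split_ifs <;> omega

theorem deficient_anti {l : ℕ} (h : k ≤ l) : deficient d l G ⊆ deficient d k G := by
  intro v; simp only [mem_deficient]; omega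

theorem addableAt_eq_image (hv : v ∈ deficient d 1 G) :
    addableAt d G v =
      (((deficient d 1 G).erase v) \ G.neighborFinset v).image (fun w => s(v, w)) := by
  ext x
  simp only [addableAt, Finset.mem_filter, Finset.mem_image, Finset.mem_sdiff, Finset.mem_erase,
    SimpleGraph.mem_neighborFinset, mem_deficient, mem_addable]
  rw [mem_deficient] at hv
  constructor
  · rintro ⟨⟨h1, h2, h3⟩, h4⟩
    obtain ⟨w, rfl⟩ := Sym2.mem_iff_exists.1 h4
    refine ⟨w, ⟨⟨?_, ?_⟩, ?_⟩, rfl⟩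
    · rintro rfl; simp at h1
    · have := h3 w (by simp); omega
    · simpa using h2
  · rintro ⟨w, ⟨⟨h1, h2⟩, h3⟩, rfl⟩
    refine ⟨⟨by simpa using h1.symm, by simpa using h3, ?_⟩, by simp⟩
    intro x hx
    rcases Sym2.mem_iff.1 hx with rfl | rfl <;> omega

theorem card_addableAt (hv : v ∈ deficient d 1 G) :
    (addableAt d G v).card = (((deficient d 1 G).erase v) \ G.neighborFinset v).card := by
  rw [addableAt_eq_image hv, Finset.card_image_of_injOn]
  exact fun a _ b _ h => Sym2.congr_right.1 h

theorem card_addableAt_lt (hv : v ∈ deficient d 1 G) :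
    (addableAt d G v).card + 1 ≤ (deficient d 1 G).card := by
  rw [card_addableAt hv]
  have h1 := Finset.card_le_card (Finset.sdiff_subset (s := (deficient d 1 G).erase v)
    (t := G.neighborFinset v))
  have h2 := Finset.card_erase_add_one hv
  omega

/-- Among the unsaturated vertices, v cannot be joined only to itself and to its neighbours, of
which there are at most d − 1. -/
theorem le_card_addableAt_add (hv : v ∈ deficient d 1 G) :
    (deficient d 1 G).card ≤ (addableAt d G v).card + d := by
  rw [card_addableAt hv]
  have h1 := Finset.le_card_sdiff (G.neighborFinset v) ((deficient d 1 G).erase v)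
  have h2 := Finset.card_erase_add_one hv
  have h3 := G.card_neighborFinset_eq_degree v
  rw [mem_deficient] at hv
  omega

theorem addableAt_eq_empty (hv : v ∉ deficient d 1 G) : addableAt d G v = ∅ := by
  rw [addableAt, Finset.filter_eq_empty_iff]
  intro e he hve
  have := (mem_addable.1 he).2.2 v hve
  exact hv (mem_deficient.2 this)

theorem card_filter_mem_of_addable (he : e ∈ addable d G) :
    (Finset.univ.filter fun v => v ∈ e).card = 2 := by
  rw [← Sym2.card_toFinset_of_not_isDiag e (mem_addable.1 he).1]
  congr 1
  ext v; simp

theorem sum_card_filter_mem (s : Finset (Fin n)) :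
    ∑ e ∈ addable d G, (s.filter fun v => v ∈ e).card = ∑ v ∈ s, (addableAt d G v).card := by
  simp only [addableAt, Finset.card_filter]
  exact Finset.sum_comm

theorem sum_card_addableAt :
    ∑ v ∈ deficient d 1 G, (addableAt d G v).card = 2 * (addable d G).card := by
  have h : ∑ v ∈ deficient d 1 G, (addableAt d G v).card = ∑ v, (addableAt d G v).card := by
    refine Finset.sum_subset (Finset.subset_univ _) fun v _ hv => ?_
    rw [addableAt_eq_empty hv, Finset.card_empty]
  rw [h, ← sum_card_filter_mem, Finset.sum_congr rfl fun e he => card_filter_mem_of_addable he,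
    Finset.sum_const, smul_eq_mul, Nat.mul_comm]

theorem two_mul_card_addable_le :
    2 * ((addable d G).card : ℝ) ≤
      (deficient d 1 G).card * ((deficient d 1 G).card - 1) := by
  have h : ∑ v ∈ deficient d 1 G, ((addableAt d G v).card : ℝ)
      ≤ ∑ _v ∈ deficient d 1 G, (((deficient d 1 G).card : ℝ) - 1) := by
    refine Finset.sum_le_sum fun v hv => ?_
    have := card_addableAt_lt hv
    have : ((addableAt d G v).card : ℝ) + 1 ≤ (deficient d 1 G).card := by exact_mod_cast this
    linarith
  rw [Finset.sum_const, nsmul_eq_mul] at h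
  have h2 : ∑ v ∈ deficient d 1 G, ((addableAt d G v).card : ℝ) = 2 * (addable d G).card := by
    exact_mod_cast sum_card_addableAt (d := d) (G := G)
  linarith

theorem le_two_mul_card_addable :
    ((deficient d 1 G).card : ℝ) * ((deficient d 1 G).card - d) ≤
      2 * ((addable d G).card : ℝ) := by
  have h : ∑ _v ∈ deficient d 1 G, (((deficient d 1 G).card : ℝ) - d) ≤
      ∑ v ∈ deficient d 1 G, ((addableAt d G v).card : ℝ) := by
    refine Finset.sum_le_sum fun v hv => ?_
    have := le_card_addableAt_add hv
    have : ((deficient d 1 G).card : ℝ) ≤ (addableAt d G v).card + d := by exact_mod_cast this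
    linarith
  rw [Finset.sum_const, nsmul_eq_mul] at h
  have h2 : ∑ v ∈ deficient d 1 G, ((addableAt d G v).card : ℝ) = 2 * (addable d G).card := by
    exact_mod_cast sum_card_addableAt (d := d) (G := G)
  linarith

theorem card_deficient_addEdge (he : e ∈ addable d G) :
    (deficient d k (addEdge G e)).card +
      ((deficient d k G \ deficient d (k + 1) G).filter fun v => v ∈ e).card =
      (deficient d k G).card := by
  rw [← Finset.card_union_of_disjoint]
  · congr 1
    ext v
    simp only [Finset.mem_union, Finset.mem_filter, Finset.mem_sdiff, mem_deficient,
      degree_addEdge he]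
    by_cases hv : v ∈ e
    · simp [hv]; omega
    · simp [hv]; try omega
  · rw [Finset.disjoint_left]
    intro v
    simp only [Finset.mem_filter, Finset.mem_sdiff, mem_deficient, degree_addEdge he]
    by_cases hv : v ∈ e
    · simp [hv]; omega
    · simp [hv]; try omega

theorem degree_addEdge_le (hdeg : ∀ v, G.degree v ≤ d) (he : e ∈ addable d G) (v : Fin n) :
    (addEdge G e).degree v ≤ d := by
  rw [degree_addEdge he]
  have := hdeg v
  split_ifs with hv
  · exact (mem_addable.1 he).2.2 v hv
  · simpa

/-- An endpoint of e that has degree d − 1 afterwards had degree d − 2 before. Hence a pair touching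
e is critical afterwards only through such a vertex, and the other critical pairs are old ones that
e misses. -/
theorem criticalPairs_addEdge_subset (he : e ∈ addable d G) :
    criticalPairs d (addEdge G e) ⊆
      (criticalPairs d G).filter (fun p => ¬ (p.1 ∈ e ∨ p.2 ∈ e)) ∪
      (((deficient d 2 G).filter fun v => v ∈ e).biUnion
        fun v => ((addEdge G e).neighborFinset v).image (fun w => (v, w)) ∪
          ((addEdge G e).neighborFinset v).image (fun w => (w, v))) := by
  rintro ⟨x, y⟩ hp
  simp only [criticalPairs, Finset.mem_filter, Finset.mem_univ, true_and] at hp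
  obtain ⟨h1, h2, h3⟩ := hp
  rw [Finset.mem_union]
  by_cases hx : x ∈ e
  · right
    rw [degree_addEdge he, if_pos hx] at h2
    simp only [Finset.mem_biUnion, Finset.mem_filter, mem_deficient, Finset.mem_union,
      Finset.mem_image, SimpleGraph.mem_neighborFinset]
    exact ⟨x, ⟨by omega, hx⟩, Or.inl ⟨y, h1, rfl⟩⟩
  by_cases hy : y ∈ e
  · right
    rw [degree_addEdge he, if_pos hy] at h3
    simp only [Finset.mem_biUnion, Finset.mem_filter, mem_deficient, Finset.mem_union,
      Finset.mem_image, SimpleGraph.mem_neighborFinset]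
    exact ⟨y, ⟨by omega, hy⟩, Or.inr ⟨x, h1.symm, rfl⟩⟩
  · left
    rw [degree_addEdge he, if_neg hx] at h2
    rw [degree_addEdge he, if_neg hy] at h3
    rw [addEdge_adj he] at h1
    simp only [criticalPairs, Finset.mem_filter, Finset.mem_univ, true_and]
    refine ⟨⟨h1.resolve_right ?_, h2, h3⟩, by tauto⟩
    rintro rfl
    simp at hx

theorem card_criticalPairs_addEdge (hdeg : ∀ v, G.degree v ≤ d) (he : e ∈ addable d G) :
    (criticalPairs d (addEdge G e)).card +
      ((criticalPairs d G).filter fun p => p.1 ∈ e ∨ p.2 ∈ e).card ≤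
      (criticalPairs d G).card + 2 * d * ((deficient d 2 G).filter fun v => v ∈ e).card := by
  have h1 := (Finset.card_le_card (criticalPairs_addEdge_subset he)).trans
    (Finset.card_union_le _ _)
  have h2 := Finset.card_filter_add_card_filter_not (s := criticalPairs d G)
    (fun p => p.1 ∈ e ∨ p.2 ∈ e)
  have h3 : (((deficient d 2 G).filter fun v => v ∈ e).biUnion
        fun v => ((addEdge G e).neighborFinset v).image (fun w => (v, w)) ∪
          ((addEdge G e).neighborFinset v).image (fun w => (w, v))).card ≤
      ((deficient d 2 G).filter fun v => v ∈ e).card * (2 * d) := by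
    refine Finset.card_biUnion_le_card_mul _ _ _ fun v _ => ?_
    refine (Finset.card_union_le _ _).trans ?_
    have h4 := degree_addEdge_le hdeg he v
    rw [← SimpleGraph.card_neighborFinset_eq_degree] at h4
    have h5 := Finset.card_image_le (s := (addEdge G e).neighborFinset v) (f := fun w => (v, w))
    have h6 := Finset.card_image_le (s := (addEdge G e).neighborFinset v) (f := fun w => (w, v))
    omega
  rw [Nat.mul_comm] at h3
  omega

/-- No addable pair contains both endpoints, since the critical pair is already an edge; the two
counts therefore add. -/
theorem card_filter_touching {p : Fin n × Fin n} (hp : p ∈ criticalPairs d G) :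
    ((addable d G).filter fun e => p.1 ∈ e ∨ p.2 ∈ e).card =
      (addableAt d G p.1).card + (addableAt d G p.2).card := by
  rw [Finset.filter_or, Finset.card_union_of_disjoint]
  · rfl
  · rw [Finset.disjoint_left]
    intro e h1 h2
    rw [Finset.mem_filter] at h1 h2
    simp only [criticalPairs, Finset.mem_filter, Finset.mem_univ, true_and] at hp
    have := (Sym2.mem_and_mem_iff hp.1.ne).1 ⟨h1.2, h2.2⟩
    have h3 := (mem_addable.1 h1.1).2.1
    rw [this] at h3
    exact h3 hp.1

theorem card_criticalPairs_le (hdeg : ∀ v, G.degree v ≤ d) :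
    (criticalPairs d G).card ≤ d * (deficient d 1 G).card := by
  have h : criticalPairs d G ⊆ (deficient d 1 G).biUnion
      fun v => (G.neighborFinset v).image (fun w => (v, w)) := by
    rintro ⟨x, y⟩ hp
    simp only [criticalPairs, Finset.mem_filter, Finset.mem_univ, true_and] at hp
    simp only [Finset.mem_biUnion, mem_deficient, Finset.mem_image,
      SimpleGraph.mem_neighborFinset]
    exact ⟨x, by omega, y, hp.1, rfl⟩
  refine (Finset.card_le_card h).trans ?_
  rw [Nat.mul_comm]
  refine Finset.card_biUnion_le_card_mul _ _ _ fun v _ => Finset.card_image_le.trans ?_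
  rw [SimpleGraph.card_neighborFinset_eq_degree]
  exact hdeg v

end

/-! ### One-step drift estimates. -/

section

variable {n d k : ℕ} {G : SimpleGraph (Fin n)} {e : Sym2 (Fin n)} {v w : Fin n}

theorem stepMean_mono {f g : SimpleGraph (Fin n) → ℝ}
    (h : ∀ e ∈ addable d G, f (addEdge G e) ≤ g (addEdge G e)) :
    stepMean d f G ≤ stepMean d g G :=
  div_le_div_of_nonneg_right (Finset.sum_le_sum h) (Nat.cast_nonneg _)

theorem stepMean_affine (hne : (addable d G).Nonempty) (a b c : ℝ)
    (f : SimpleGraph (Fin n) → ℝ) :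
    stepMean d (fun H => a + b * (f H - c)) G = a + b * (stepMean d f G - c) := by
  have : ((addable d G).card : ℝ) ≠ 0 := by exact_mod_cast hne.card_pos.ne'
  simp only [stepMean, Finset.sum_add_distrib, ← Finset.mul_sum, Finset.sum_sub_distrib,
    Finset.sum_const, nsmul_eq_mul]
  field_simp

theorem stepMean_div (c : ℝ) (f : SimpleGraph (Fin n) → ℝ) :
    stepMean d (fun H => f H / c) G = stepMean d f G / c := by
  simp only [stepMean, ← Finset.sum_div]
  ring

theorem le_sum_card_addableAt {s : Finset (Fin n)} (hs : s ⊆ deficient d 1 G) :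
    (s.card : ℝ) * ((deficient d 1 G).card - d) ≤ ∑ v ∈ s, ((addableAt d G v).card : ℝ) := by
  rw [← nsmul_eq_mul, ← Finset.sum_const]
  refine Finset.sum_le_sum fun v hv => ?_
  have := le_card_addableAt_add (hs hv)
  have : ((deficient d 1 G).card : ℝ) ≤ (addableAt d G v).card + d := by exact_mod_cast this
  linarith

theorem sum_card_addableAt_le {s : Finset (Fin n)} (hs : s ⊆ deficient d 1 G) :
    ∑ v ∈ s, ((addableAt d G v).card : ℝ) ≤ (s.card : ℝ) * ((deficient d 1 G).card - 1) := by
  rw [← nsmul_eq_mul, ← Finset.sum_const]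
  refine Finset.sum_le_sum fun v hv => ?_
  have := card_addableAt_lt (hs hv)
  have : ((addableAt d G v).card : ℝ) + 1 ≤ (deficient d 1 G).card := by exact_mod_cast this
  linarith

theorem card_addable_pos (hd : 1 ≤ d) (hu : d < (deficient d 1 G).card) :
    0 < ((addable d G).card : ℝ) := by
  have h := le_two_mul_card_addable (d := d) (G := G)
  have h1 : (d : ℝ) < (deficient d 1 G).card := by exact_mod_cast hu
  have h2 : (1 : ℝ) ≤ d := by exact_mod_cast hd
  nlinarith

/-- Only vertices of degree exactly d − k can leave the set, and they leave when hit. With u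
unsaturated vertices, at least u − d addable pairs hit a given one, out of at most u²/2. -/
theorem stepMean_card_deficient_le (hd : 1 ≤ d) (hk : 1 ≤ k)
    (hu : d < (deficient d 1 G).card) :
    stepMean d (fun H => ((deficient d k H).card : ℝ)) G ≤
      (deficient d k G).card - 2 / (deficient d 1 G).card * (1 - d / (deficient d 1 G).card) *
        ((deficient d k G).card - (deficient d (k + 1) G).card) := by
  set u := ((deficient d 1 G).card : ℝ) with hu_def
  have hM := card_addable_pos hd hu
  have h1 : (d : ℝ) < u := by rw [hu_def]; exact_mod_cast hu
  have h2 : (1 : ℝ) ≤ d := by exact_mod_cast hd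
  set X := deficient d k G \ deficient d (k + 1) G with hX
  have hXc : (X.card : ℝ) = (deficient d k G).card - (deficient d (k + 1) G).card := by
    rw [hX, Finset.card_sdiff_of_subset (deficient_anti (Nat.le_succ k)),
      Nat.cast_sub (Finset.card_le_card (deficient_anti (Nat.le_succ k)))]
  have hXs : X ⊆ deficient d 1 G := Finset.sdiff_subset.trans (deficient_anti hk)
  rw [← hXc]
  have hsum : ∑ e ∈ addable d G, ((deficient d k (addEdge G e)).card : ℝ) +
      ∑ v ∈ X, ((addableAt d G v).card : ℝ) = (addable d G).card * (deficient d k G).card := by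
    have h3 : ∑ v ∈ X, ((addableAt d G v).card : ℝ) =
        ∑ e ∈ addable d G, ((X.filter fun v => v ∈ e).card : ℝ) := by
      exact_mod_cast (sum_card_filter_mem (d := d) (G := G) X).symm
    rw [h3, ← Finset.sum_add_distrib, ← nsmul_eq_mul, ← Finset.sum_const]
    refine Finset.sum_congr rfl fun e he => ?_
    exact_mod_cast card_deficient_addEdge he
  have h4 := le_sum_card_addableAt hXs
  have h5 := two_mul_card_addable_le (d := d) (G := G)
  rw [← hu_def] at h4 h5
  rw [stepMean, div_le_iff₀ hM]
  have h6 : 2 / u * (1 - d / u) * X.card * (addable d G).card ≤ X.card * (u - d) := by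
    have h7 : 2 / u * (1 - d / u) * X.card * (addable d G).card =
      X.card * (u - d) * (2 * (addable d G).card / u ^ 2) := by
      have : u ≠ 0 := by linarith
      field_simp
    rw [h7]
    have h8 : 2 * ((addable d G).card : ℝ) / u ^ 2 ≤ 1 := by
      rw [div_le_one (by nlinarith)]
      nlinarith
    have h9 : 0 ≤ (X.card : ℝ) * (u - d) := mul_nonneg (Nat.cast_nonneg _) (by linarith)
    nlinarith
  nlinarith

/-- The fraction `|deficient d k G| / D`. -/
noncomputable def frac {n : ℕ} (d k : ℕ) (D : ℝ) (G : SimpleGraph (Fin n)) : ℝ :=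
  (deficient d k G).card / D

theorem frac_nonneg {D : ℝ} (hD : 0 ≤ D) : 0 ≤ frac d k D G :=
  div_nonneg (Nat.cast_nonneg _) hD

theorem frac_anti {D : ℝ} (hD : 0 ≤ D) {l : ℕ} (h : k ≤ l) : frac d l D G ≤ frac d k D G :=
  div_le_div_of_nonneg_right (Nat.cast_le.2 (Finset.card_le_card (deficient_anti h))) hD

theorem frac_le_one {D : ℝ} (hD : 0 < D) (h : (deficiency d G : ℝ) = D) (hk : 1 ≤ k) :
    frac d k D G ≤ 1 := by
  refine (frac_anti hD.le hk).trans ?_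
  rw [frac, div_le_one hD, ← h]
  exact_mod_cast (Nat.le_add_right _ _).trans (card_add_card_le_deficiency (d := d) (G := G))

theorem frac_eq_zero {D : ℝ} (hk : d < k) : frac d k D G = 0 := by
  have : deficient d k G = ∅ := by
    ext v; simp only [mem_deficient, Finset.notMem_empty, iff_false]; omega
  simp [frac, this]

theorem lt_card_deficient_of_lt (c : ℕ) (h : d * c < deficiency d G) :
    c < (deficient d 1 G).card := by
  by_contra! h1
  have := (deficiency_le (d := d) (G := G)).trans (Nat.mul_le_mul_left d h1)
  omega

/-- The basic drift inequality. The deficiency falls from q + 2 to q, so the normalisation changes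
along with the count. -/
theorem stepMean_frac_le (hd : 1 ≤ d) (hk : 1 ≤ k) {q : ℝ} (hq : (d : ℝ) ^ 2 ≤ q)
    (hD : (deficiency d G : ℝ) = q + 2) :
    stepMean d (frac d k q) G ≤ frac d k (q + 2) G + 2 / q *
      (-(frac d 2 (q + 2) G * frac d k (q + 2) G) + 2 * frac d (k + 1) (q + 2) G +
        2 * d ^ 2 * frac d k (q + 2) G / q) := by
  have hd1 : (1 : ℝ) ≤ d := by exact_mod_cast hd
  have hq0 : 0 < q := by nlinarith
  have hu : d < (deficient d 1 G).card := by
    apply lt_card_deficient_of_lt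
    have : ((d * d : ℕ) : ℝ) < deficiency d G := by rw [hD]; push_cast; nlinarith
    exact_mod_cast this
  have h1 := stepMean_card_deficient_le hd hk hu
  have hu' : (d : ℝ) < (deficient d 1 G).card := by exact_mod_cast hu
  have hle : ((deficient d 1 G).card : ℝ) + (deficient d 2 G).card ≤ q + 2 := by
    rw [← hD]; exact_mod_cast card_add_card_le_deficiency (d := d) (G := G)
  have hge : q + 2 ≤ d * ((deficient d 1 G).card : ℝ) := by
    rw [← hD]; exact_mod_cast deficiency_le (d := d) (G := G)
  have hz2 : frac d 2 (q + 2) G ≤ 1 := frac_le_one (by linarith) hD (by norm_num)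
  have hz20 : 0 ≤ frac d 2 (q + 2) G := frac_nonneg (by linarith)
  have hb0 : 0 ≤ frac d (k + 1) (q + 2) G := frac_nonneg (by linarith)
  have hba : frac d (k + 1) (q + 2) G ≤ frac d k (q + 2) G :=
    frac_anti (by linarith) (Nat.le_succ k)
  have e2 : ((deficient d 2 G).card : ℝ) = (q + 2) * frac d 2 (q + 2) G := by
    rw [frac]; field_simp
  have ea : ((deficient d k G).card : ℝ) = (q + 2) * frac d k (q + 2) G := by
    rw [frac]; field_simp
  have eb : ((deficient d (k + 1) G).card : ℝ) = (q + 2) * frac d (k + 1) (q + 2) G := by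
    rw [frac]; field_simp
  rw [ea, eb] at h1
  rw [e2] at hle
  have hfr : stepMean d (frac d k q) G =
    stepMean d (fun H => ((deficient d k H).card : ℝ)) G / q := stepMean_div q _
  rw [hfr]
  generalize stepMean d (fun H => ((deficient d k H).card : ℝ)) G = m at *
  generalize ((deficient d 1 G).card : ℝ) = u at *
  generalize frac d 2 (q + 2) G = z at *
  generalize frac d k (q + 2) G = a at *
  generalize frac d (k + 1) (q + 2) G = b at *
  clear hfr hD ea eb e2
  generalize (d : ℝ) = c at *
  have hu0 : 0 < u := by linarith
  have hD0 : 0 < q + 2 := by linarith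
  -- From u ≤ (q + 2)(1 − z) and (1 − z)(1 + z) ≤ 1.
  have f1 : (1 + z) / (q + 2) ≤ 1 / u := by
    rw [div_le_div_iff₀ hD0 hu0]
    nlinarith [mul_nonneg hz20 hz20]
  have f2 : c / u ≤ c ^ 2 / q := by
    rw [div_le_div_iff₀ hu0 hq0]
    nlinarith
  have f3 : c / u ≤ 1 := by rw [div_le_one hu0]; linarith
  set κ := c ^ 2 / q with hκ
  have hκ1 : κ ≤ 1 := by rw [hκ, div_le_one hq0]; linarith
  have hκ0 : 0 ≤ κ := by positivity
  have f4 : (1 + z) / (q + 2) * (1 - κ) ≤ 1 / u * (1 - c / u) := by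
    apply mul_le_mul f1 (by linarith) (by linarith) (by positivity)
  have f5 : 2 * ((1 + z) / (q + 2) * (1 - κ)) * ((q + 2) * a - (q + 2) * b) ≤
      2 / u * (1 - c / u) * ((q + 2) * a - (q + 2) * b) := by
    have : 0 ≤ (q + 2) * a - (q + 2) * b := by nlinarith
    have h7 : 2 / u * (1 - c / u) = 2 * (1 / u * (1 - c / u)) := by ring
    rw [h7]
    apply mul_le_mul_of_nonneg_right _ this
    linarith
  have f6 : 2 * ((1 + z) / (q + 2) * (1 - κ)) * ((q + 2) * a - (q + 2) * b) =
      2 * ((1 + z) * (1 - κ) * (a - b)) := by field_simp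
  rw [div_le_iff₀ hq0]
  have f7 : (a + 2 / q * (-(z * a) + 2 * b + 2 * c ^ 2 * a / q)) * q =
      a * q + 2 * (-(z * a) + 2 * b + 2 * κ * a) := by
    rw [hκ]; field_simp
  rw [f7]
  -- The leading a is the gain from dividing by q instead of q + 2. It cancels the linear part of
  -- the loss, so only the quadratic damping survives.
  have f8 : a - (1 + z) * (1 - κ) * (a - b) ≤ -(z * a) + 2 * b + 2 * κ * a := by
    have g1 : κ * ((1 + z) * (a - b)) ≤ κ * (2 * a) := by
      apply mul_le_mul_of_nonneg_left _ hκ0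
      nlinarith
    nlinarith
  linarith

/-- First-order Taylor bound with a quadratic error uniform on [0, 1]. It turns a drift for z into a
drift for its powers. -/
theorem pow_le_pow_add_linear {x y : ℝ} (hx : 0 ≤ x) (hx1 : x ≤ 1) (hy : 0 ≤ y) (hy1 : y ≤ 1)
    (p : ℕ) : y ^ (p + 1) ≤
      x ^ (p + 1) + (p + 1) * x ^ p * (y - x) + (p + 1) ^ 2 * (y - x) ^ 2 := by
  induction p with
  | zero => simp; nlinarith
  | succ p ih =>
    have h1 : y ^ (p + 2) ≤
        y * (x ^ (p + 1) + (p + 1) * x ^ p * (y - x) + (p + 1) ^ 2 * (y - x) ^ 2) := by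
      rw [pow_succ y (p + 1), mul_comm]
      exact mul_le_mul_of_nonneg_left ih hy
    have h2 : y * ((y - x) ^ 2) ≤ (y - x) ^ 2 := by nlinarith [sq_nonneg (y - x)]
    have h3 : x ^ p * (y - x) ^ 2 ≤ (y - x) ^ 2 := by
      nlinarith [sq_nonneg (y - x), pow_le_one₀ hx hx1 (n := p)]
    have hp : (0 : ℝ) ≤ p := Nat.cast_nonneg p
    push_cast
    have h4 : y * (x ^ (p + 1) + (p + 1) * x ^ p * (y - x) + (p + 1) ^ 2 * (y - x) ^ 2) =
      x ^ (p + 2) + (p + 2) * x ^ (p + 1) * (y - x) + (p + 1) * (x ^ p * (y - x) ^ 2) +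
        (p + 1) ^ 2 * (y * (y - x) ^ 2) := by ring
    have h5 := mul_le_mul_of_nonneg_left h2 (by positivity : (0 : ℝ) ≤ (p + 1) ^ 2)
    have h6 := mul_le_mul_of_nonneg_left h3 (by positivity : (0 : ℝ) ≤ p + 1)
    have h7 : 0 ≤ (p : ℝ) * (y - x) ^ 2 := by positivity
    nlinarith [sq_nonneg (y - x)]

/-- Each vertex accounts for at most d of the deficiency, so more than d vertices are unsaturated,
and these cannot all be adjacent to one of them. -/
theorem addable_nonempty_of_lt (hd : 1 ≤ d) (h : d * d < deficiency d G) :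
    (addable d G).Nonempty := by
  rw [← Finset.card_pos]
  exact_mod_cast card_addable_pos hd (lt_card_deficient_of_lt d h)

theorem deficiency_addEdge (hdeg : ∀ v, G.degree v ≤ d) (he : e ∈ addable d G) :
    deficiency d (addEdge G e) + 2 = deficiency d G := by
  have h1 := deficiency_add_two_mul_card hdeg
  have h2 := deficiency_add_two_mul_card (degree_addEdge_le hdeg he)
  have h3 := (addEdge_degree_card he hdeg).2
  have h4 : (addEdge G e).edgeFinset.card = G.edgeFinset.card + 1 := by convert h3
  omega

theorem sq_frac_addEdge_sub_le (hk : 1 ≤ k) {q : ℝ} (hq : 0 < q)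
    (hD : (deficiency d G : ℝ) = q + 2) (he : e ∈ addable d G) :
    (frac d k q (addEdge G e) - frac d k (q + 2) G) ^ 2 ≤ (2 / q) ^ 2 := by
  have hz1 : frac d k (q + 2) G ≤ 1 := frac_le_one (by linarith) hD hk
  have hz0 : 0 ≤ frac d k (q + 2) G := frac_nonneg (by linarith)
  have h1 := card_deficient_addEdge (k := k) he
  have h2 : ((deficient d k G \ deficient d (k + 1) G).filter fun v => v ∈ e).card ≤ 2 := by
    rw [← card_filter_mem_of_addable he]
    exact Finset.card_le_card (Finset.filter_subset_filter _ (Finset.subset_univ _))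
  have h1' : ((deficient d k (addEdge G e)).card : ℝ) +
      ((deficient d k G \ deficient d (k + 1) G).filter fun v => v ∈ e).card =
      (deficient d k G).card := by exact_mod_cast h1
  have h2' : (((deficient d k G \ deficient d (k + 1) G).filter fun v => v ∈ e).card : ℝ) ≤ 2 := by
    exact_mod_cast h2
  have ea : ((deficient d k G).card : ℝ) = (q + 2) * frac d k (q + 2) G := by
    rw [frac]; field_simp
  have h3 : frac d k q (addEdge G e) - frac d k (q + 2) G = (2 * frac d k (q + 2) G -
      ((deficient d k G \ deficient d (k + 1) G).filter fun v => v ∈ e).card) / q := by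
    rw [eq_div_iff hq.ne', sub_mul]
    have : frac d k q (addEdge G e) * q = (deficient d k (addEdge G e)).card := by
      rw [frac]; field_simp
    rw [this]
    linarith
  rw [h3, div_pow, div_pow]
  apply div_le_div_of_nonneg_right _ (by positivity)
  have : (0 : ℝ) ≤ ((deficient d k G \ deficient d (k + 1) G).filter fun v => v ∈ e).card :=
    Nat.cast_nonneg _
  apply sq_le_sq'
  · linarith
  · linarith

/-- Jumps of the fraction are at most 2/q, so passing to powers costs only O(1/q²), which is
summable over time. -/
theorem stepMean_frac_pow_le (hd : 1 ≤ d) (hk : 1 ≤ k) {q : ℝ} (hq : (d : ℝ) ^ 2 ≤ q)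
    (hdeg : ∀ v, G.degree v ≤ d) (hD : (deficiency d G : ℝ) = q + 2) (p : ℕ) :
    stepMean d (fun H => frac d k q H ^ (p + 1)) G ≤ frac d k (q + 2) G ^ (p + 1) + 2 / q *
      ((p + 1) * frac d k (q + 2) G ^ p *
        (-(frac d 2 (q + 2) G * frac d k (q + 2) G) + 2 * frac d (k + 1) (q + 2) G)) +
      4 * ((p + 1) * d ^ 2 + (p + 1) ^ 2) / q ^ 2 := by
  have hd1 : (1 : ℝ) ≤ d := by exact_mod_cast hd
  have hq0 : 0 < q := by nlinarith
  have hne : (addable d G).Nonempty := by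
    apply addable_nonempty_of_lt hd
    have : ((d * d : ℕ) : ℝ) < deficiency d G := by rw [hD]; push_cast; nlinarith
    exact_mod_cast this
  have hz1 : frac d k (q + 2) G ≤ 1 := frac_le_one (by linarith) hD hk
  have hz0 : 0 ≤ frac d k (q + 2) G := frac_nonneg (by linarith)
  have h1 : stepMean d (fun H => frac d k q H ^ (p + 1)) G ≤
      stepMean d (fun H => (frac d k (q + 2) G ^ (p + 1) + (p + 1) ^ 2 * (2 / q) ^ 2) +
        ((p + 1) * frac d k (q + 2) G ^ p) * (frac d k q H - frac d k (q + 2) G)) G := by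
    refine stepMean_mono fun e he => ?_
    have hD' : (deficiency d (addEdge G e) : ℝ) = q := by
      have : (deficiency d (addEdge G e) : ℝ) + 2 = deficiency d G := by
        exact_mod_cast deficiency_addEdge hdeg he
      linarith
    have h2 := pow_le_pow_add_linear hz0 hz1 (frac_nonneg (G := addEdge G e) hq0.le)
      (frac_le_one hq0 hD' hk) p
    have h3 := mul_le_mul_of_nonneg_left (sq_frac_addEdge_sub_le hk hq0 hD he)
      (by positivity : (0 : ℝ) ≤ (p + 1) ^ 2)
    linarith
  rw [stepMean_affine hne] at h1
  refine h1.trans ?_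
  have h4 := stepMean_frac_le hd hk hq hD
  generalize stepMean d (frac d k q) G = m at *
  have hzp : 0 ≤ frac d k (q + 2) G ^ p := pow_nonneg hz0 p
  have hzp1 : frac d k (q + 2) G ^ (p + 1) ≤ 1 := pow_le_one₀ hz0 hz1
  have h5 := mul_le_mul_of_nonneg_left (sub_le_iff_le_add'.2 h4)
    (by positivity : (0 : ℝ) ≤ (p + 1) * frac d k (q + 2) G ^ p)
  have h6 : (p + 1) * frac d k (q + 2) G ^ p * (2 / q *
      (-(frac d 2 (q + 2) G * frac d k (q + 2) G) + 2 * frac d (k + 1) (q + 2) G +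
        2 * d ^ 2 * frac d k (q + 2) G / q)) = 2 / q *
      ((p + 1) * frac d k (q + 2) G ^ p *
        (-(frac d 2 (q + 2) G * frac d k (q + 2) G) + 2 * frac d (k + 1) (q + 2) G)) +
      4 * ((p + 1) * d ^ 2) / q ^ 2 * frac d k (q + 2) G ^ (p + 1) := by
    field_simp; ring
  have h7 : 4 * ((p + 1) * (d : ℝ) ^ 2) / q ^ 2 * frac d k (q + 2) G ^ (p + 1) ≤
      4 * ((p + 1) * (d : ℝ) ^ 2) / q ^ 2 :=
    mul_le_of_le_one_right (by positivity) hzp1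
  have h8 : 4 * ((p + 1) * (d : ℝ) ^ 2 + (p + 1) ^ 2) / q ^ 2 =
    4 * ((p + 1) * (d : ℝ) ^ 2) / q ^ 2 + (p + 1) ^ 2 * (2 / q) ^ 2 := by
    field_simp; ring
  rw [h8]
  linarith

/-- A critical pair dies when either endpoint is hit, twice the rate for a single vertex. This
outweighs the shrinking normalisation, so the damping is linear here; new pairs need a hit on a
vertex of degree at most d − 2. -/
theorem stepMean_criticalPairs_le (hd : 1 ≤ d) (hdeg : ∀ v, G.degree v ≤ d) {q : ℝ}
    (hq : 4 * (d : ℝ) ^ 2 ≤ q) (hD : (deficiency d G : ℝ) = q + 2) :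
    stepMean d (fun H => ((criticalPairs d H).card : ℝ) / q) G ≤
      ((criticalPairs d G).card : ℝ) / (q + 2) * (1 - 1 / q) +
        6 * d ^ 2 * frac d 2 (q + 2) G / q := by
  have hd1 : (1 : ℝ) ≤ d := by exact_mod_cast hd
  have hq0 : 0 < q := by nlinarith
  have hu : d * 4 < (deficient d 1 G).card := by
    apply lt_card_deficient_of_lt
    have : ((d * (d * 4) : ℕ) : ℝ) < deficiency d G := by rw [hD]; push_cast; nlinarith
    exact_mod_cast this
  have hM := card_addable_pos hd (by omega : d < (deficient d 1 G).card)
  rw [stepMean_div]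
  have hu' : (d : ℝ) * 4 < (deficient d 1 G).card := by exact_mod_cast hu
  have hle : ((deficient d 1 G).card : ℝ) + (deficient d 2 G).card ≤ q + 2 := by
    rw [← hD]; exact_mod_cast card_add_card_le_deficiency (d := d) (G := G)
  have hge : q + 2 ≤ d * ((deficient d 1 G).card : ℝ) := by
    rw [← hD]; exact_mod_cast deficiency_le (d := d) (G := G)
  have hsum : ∑ e ∈ addable d G, ((criticalPairs d (addEdge G e)).card : ℝ) +
      ∑ p ∈ criticalPairs d G, (((addableAt d G p.1).card : ℝ) + (addableAt d G p.2).card) ≤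
      (addable d G).card * (criticalPairs d G).card +
        2 * d * ∑ v ∈ deficient d 2 G, ((addableAt d G v).card : ℝ) := by
    have h3 : ∑ v ∈ deficient d 2 G, ((addableAt d G v).card : ℝ) =
        ∑ e ∈ addable d G, (((deficient d 2 G).filter fun v => v ∈ e).card : ℝ) := by
      exact_mod_cast (sum_card_filter_mem (d := d) (G := G) _).symm
    have h4 : ∑ p ∈ criticalPairs d G,
        (((addableAt d G p.1).card : ℝ) + (addableAt d G p.2).card) =
        ∑ e ∈ addable d G, (((criticalPairs d G).filter fun p => p.1 ∈ e ∨ p.2 ∈ e).card : ℝ) := by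
      have h5 : ∑ p ∈ criticalPairs d G, ((addableAt d G p.1).card + (addableAt d G p.2).card) =
          ∑ e ∈ addable d G, ((criticalPairs d G).filter fun p => p.1 ∈ e ∨ p.2 ∈ e).card := by
        rw [← Finset.sum_congr rfl fun p hp => card_filter_touching hp]
        simp only [Finset.card_filter]
        exact Finset.sum_comm
      exact_mod_cast h5
    rw [h3, h4, ← Finset.sum_add_distrib, Finset.mul_sum, ← nsmul_eq_mul, ← Finset.sum_const,
      ← Finset.sum_add_distrib]
    refine Finset.sum_le_sum fun e he => ?_
    exact_mod_cast card_criticalPairs_addEdge hdeg he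
  have h4 : ((criticalPairs d G).card : ℝ) * (2 * ((deficient d 1 G).card - d)) ≤
      ∑ p ∈ criticalPairs d G, (((addableAt d G p.1).card : ℝ) + (addableAt d G p.2).card) := by
    rw [← nsmul_eq_mul, ← Finset.sum_const]
    refine Finset.sum_le_sum fun p hp => ?_
    simp only [criticalPairs, Finset.mem_filter, Finset.mem_univ, true_and] at hp
    have h5 := le_card_addableAt_add (v := p.1) (mem_deficient.2 (by omega : G.degree p.1 + 1 ≤ d))
    have h6 := le_card_addableAt_add (v := p.2) (mem_deficient.2 (by omega : G.degree p.2 + 1 ≤ d))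
    have : ((deficient d 1 G).card : ℝ) ≤ (addableAt d G p.1).card + d := by exact_mod_cast h5
    have : ((deficient d 1 G).card : ℝ) ≤ (addableAt d G p.2).card + d := by exact_mod_cast h6
    linarith
  have h5 := sum_card_addableAt_le (deficient_anti (d := d) (G := G) (by norm_num : 1 ≤ 2))
  have h6 := two_mul_card_addable_le (d := d) (G := G)
  have h7 := le_two_mul_card_addable (d := d) (G := G)
  have hB : (0 : ℝ) ≤ (criticalPairs d G).card := Nat.cast_nonneg _
  have hY : (0 : ℝ) ≤ (deficient d 2 G).card := Nat.cast_nonneg _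
  rw [stepMean, div_div, div_le_iff₀ (by positivity), frac]
  generalize ∑ e ∈ addable d G, ((criticalPairs d (addEdge G e)).card : ℝ) = S at *
  generalize ∑ p ∈ criticalPairs d G,
    (((addableAt d G p.1).card : ℝ) + (addableAt d G p.2).card) = S1 at *
  generalize ∑ v ∈ deficient d 2 G, ((addableAt d G v).card : ℝ) = S2 at *
  generalize ((criticalPairs d G).card : ℝ) = B at *
  generalize ((deficient d 2 G).card : ℝ) = Y at *
  generalize ((deficient d 1 G).card : ℝ) = u at *
  generalize ((addable d G).card : ℝ) = M at *
  clear hD hdeg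
  generalize (d : ℝ) = c at *
  have hu0 : 0 < u := by linarith
  have hD0 : 0 < q + 2 := by linarith
  -- The true rate is about 4/u; the slack down to 3 absorbs c because u > 4c. The factor 1 − 3/(q +
  -- 2), renormalised by (q + 2)/q, is exactly 1 − 1/q.
  have g1 : 3 / (q + 2) * M ≤ 2 * (u - c) := by
    rw [div_mul_eq_mul_div, div_le_iff₀ hD0]
    have : 3 * M ≤ 2 * (u - c) * u := by nlinarith
    nlinarith
  have g2 : (u - 1) ≤ 3 * c / (q + 2) * M := by
    have : (u - 1) * u ≤ 3 * M := by nlinarith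
    rw [div_mul_eq_mul_div, le_div_iff₀ hD0]
    have : (u - 1) * (q + 2) ≤ (u - 1) * (c * u) :=
      mul_le_mul_of_nonneg_left hge (by linarith)
    nlinarith
  have g3 : S ≤ M * B - B * (3 / (q + 2) * M) + 2 * c * (Y * (3 * c / (q + 2) * M)) := by
    have k1 := mul_le_mul_of_nonneg_left g1 hB
    have k2 := mul_le_mul_of_nonneg_left g2 hY
    have k3 := mul_le_mul_of_nonneg_left (h5.trans k2) (by linarith : 0 ≤ 2 * c)
    linarith
  refine g3.trans (le_of_eq ?_)
  field_simp
  ring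

end

/-! ### Expectations, and time counted by remaining steps. -/

section

/-- The expectation of `f` under a probability mass function on a finite type. -/
noncomputable def mean {α : Type*} [Fintype α] (p : PMF α) (f : α → ℝ) : ℝ :=
  ∑ a, (p a).toReal * f a

section Mean

variable {α β : Type*} [Fintype α] [Fintype β] (p : PMF α)

theorem mean_mono {f g : α → ℝ} (h : ∀ a ∈ p.support, f a ≤ g a) : mean p f ≤ mean p g := by
  refine Finset.sum_le_sum fun a _ => ?_
  by_cases ha : a ∈ p.support
  · exact mul_le_mul_of_nonneg_left (h a ha) ENNReal.toReal_nonneg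
  · rw [PMF.mem_support_iff, not_not] at ha
    simp [ha]

theorem mean_add (f g : α → ℝ) : mean p (fun a => f a + g a) = mean p f + mean p g := by
  simp only [mean, mul_add, Finset.sum_add_distrib]

theorem mean_mul_left (c : ℝ) (f : α → ℝ) : mean p (fun a => c * f a) = c * mean p f := by
  simp only [mean, Finset.mul_sum]
  exact Finset.sum_congr rfl fun a _ => by ring

theorem sum_toReal : ∑ a, (p a).toReal = 1 := by
  rw [← ENNReal.toReal_sum fun a _ => p.apply_ne_top a,
    ← tsum_fintype (L := .unconditional _), p.tsum_coe, ENNReal.toReal_one]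

theorem mean_const (c : ℝ) : mean p (fun _ => c) = c := by
  rw [mean, ← Finset.sum_mul, sum_toReal, one_mul]

theorem mean_nonneg {f : α → ℝ} (h : ∀ a ∈ p.support, 0 ≤ f a) : 0 ≤ mean p f := by
  rw [← mean_const p 0]
  exact mean_mono p h

theorem mean_pure (a : α) (f : α → ℝ) : mean (PMF.pure a) f = f a := by
  rw [mean, Finset.sum_eq_single a]
  · simp
  · intro b _ hb
    simp [PMF.pure_apply, hb]
  · simp

theorem mean_bind (q : α → PMF β) (f : β → ℝ) :
    mean (p.bind q) f = mean p (fun a => mean (q a) f) := by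
  simp only [mean, PMF.bind_apply, tsum_fintype, Finset.mul_sum]
  rw [Finset.sum_comm]
  refine Finset.sum_congr rfl fun b _ => ?_
  rw [ENNReal.toReal_sum fun a _ => ENNReal.mul_ne_top (p.apply_ne_top a) ((q a).apply_ne_top b),
    Finset.sum_mul]
  refine Finset.sum_congr rfl fun a _ => ?_
  rw [ENNReal.toReal_mul, mul_assoc]

theorem mean_map (g : α → β) (f : β → ℝ) : mean (p.map g) f = mean p (fun a => f (g a)) := by
  rw [PMF.map, mean_bind]
  simp only [Function.comp_apply, mean_pure]

theorem mean_uniformOfFinset (s : Finset α) (hs : s.Nonempty) (f : α → ℝ) :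
    mean (PMF.uniformOfFinset s hs) f = (∑ a ∈ s, f a) / s.card := by
  simp only [mean, PMF.uniformOfFinset_apply]
  rw [Finset.sum_div, ← Finset.sum_subset (Finset.subset_univ s)]
  · refine Finset.sum_congr rfl fun a ha => ?_
    rw [if_pos ha]
    simp
    ring
  · intro a _ ha
    rw [if_neg ha]
    simp

theorem pow_mean_le {f : α → ℝ} (h : ∀ a, 0 ≤ f a) (m : ℕ) :
    mean p f ^ m ≤ mean p (fun a => f a ^ m) :=
  Real.pow_arith_mean_le_arith_mean_pow _ _ _ (fun _ _ => ENNReal.toReal_nonneg) (sum_toReal p)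
    (fun a _ => h a) m

end Mean

variable {n d k : ℕ} {G : SimpleGraph (Fin n)}

theorem mean_step (h : (addable d G).Nonempty) (f : SimpleGraph (Fin n) → ℝ) :
    mean (step d G) f = stepMean d f G := by
  rw [step, dif_pos h, mean_map, mean_uniformOfFinset, stepMean]

theorem card_edgeFinset_le_of_mem_support_law (d n s : ℕ) :
    ∀ G ∈ (law d n s).support, G.edgeFinset.card ≤ s := by
  induction s with
  | zero =>
    intro G hG
    simp only [law, PMF.support_pure, Set.mem_singleton_iff] at hG
    subst hG
    simp
  | succ s ih =>
    intro G hG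
    simp only [law, PMF.mem_support_bind_iff] at hG
    obtain ⟨H, hH, hG⟩ := hG
    have hs := ih H hH
    have hdeg := (law_invariant d n s H hH).1
    unfold step at hG
    split_ifs at hG with hne
    · simp only [PMF.mem_support_map_iff, PMF.mem_support_uniformOfFinset_iff] at hG
      obtain ⟨e, he, rfl⟩ := hG
      rw [edgeFinset_addEdge he]
      exact (Finset.card_insert_le _ _).trans (by omega)
    · simp only [PMF.support_pure, Set.mem_singleton_iff] at hG
      subst hG
      omega

/-- The deficiency when `r` of the `⌊dn/2⌋` steps remain. -/
noncomputable def remDeficiency (d n r : ℕ) : ℝ := 2 * r + (d * n % 2 : ℕ)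

/-- The expectation of `f` when `r` of the `⌊dn/2⌋` steps remain. -/
noncomputable def remMean (d n r : ℕ) (f : SimpleGraph (Fin n) → ℝ) : ℝ :=
  mean (law d n (d * n / 2 - r)) f

theorem remDeficiency_succ (d n r : ℕ) : remDeficiency d n (r + 1) = remDeficiency d n r + 2 := by
  simp only [remDeficiency]; push_cast; ring

theorem two_mul_le_remDeficiency (d n r : ℕ) : 2 * (r : ℝ) ≤ remDeficiency d n r := by
  simp [remDeficiency]

theorem remDeficiency_le (d n : ℕ) {r : ℕ} (hr : 1 ≤ r) : remDeficiency d n r ≤ 3 * r := by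
  have h1 : ((d * n % 2 : ℕ) : ℝ) ≤ 1 := by
    exact_mod_cast Nat.le_of_lt_succ (Nat.mod_lt _ (by norm_num))
  have h2 : (1 : ℝ) ≤ r := by exact_mod_cast hr
  simp only [remDeficiency]; linarith

/-- The edge count can lag behind the number of steps only in a stuck graph. But having at most
⌊dn/2⌋ − r edges forces deficiency at least 2r > d², hence an addable pair. -/
theorem deficiency_of_mem_support {r : ℕ} (hd : 1 ≤ d) (hr : r ≤ d * n / 2) (hdr : d * d < 2 * r)
    (hG : G ∈ (law d n (d * n / 2 - r)).support) :
    (∀ v, G.degree v ≤ d) ∧ (deficiency d G : ℝ) = remDeficiency d n r := by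
  obtain ⟨h1, h2⟩ := law_invariant d n _ G hG
  refine ⟨h1, ?_⟩
  have h3 := card_edgeFinset_le_of_mem_support_law d n _ G hG
  have h4 := deficiency_add_two_mul_card h1
  have h5 : G.edgeFinset.card = d * n / 2 - r := by
    rcases h2 with h2 | h2
    · have := addable_nonempty_of_lt (d := d) (G := G) hd (by omega)
      rw [h2] at this
      simp at this
    · convert h2
  have h6 : deficiency d G = 2 * r + d * n % 2 := by omega
  rw [h6, remDeficiency]
  push_cast
  rfl

theorem remMean_mono {r : ℕ} (hd : 1 ≤ d) (hr : r ≤ d * n / 2) (hdr : d * d < 2 * r)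
    {f g : SimpleGraph (Fin n) → ℝ}
    (h : ∀ G, (∀ v, G.degree v ≤ d) → (deficiency d G : ℝ) = remDeficiency d n r → f G ≤ g G) :
    remMean d n r f ≤ remMean d n r g :=
  mean_mono _ fun G hG =>
    h G (deficiency_of_mem_support hd hr hdr hG).1 (deficiency_of_mem_support hd hr hdr hG).2

theorem remMean_step_le {r : ℕ} (hd : 1 ≤ d) (hr : r < d * n / 2) (hdr : d * d < 2 * r)
    {f g : SimpleGraph (Fin n) → ℝ}
    (h : ∀ G, (∀ v, G.degree v ≤ d) → (deficiency d G : ℝ) = remDeficiency d n r + 2 →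
      stepMean d f G ≤ g G) :
    remMean d n r f ≤ remMean d n (r + 1) g := by
  have h1 : d * n / 2 - r = (d * n / 2 - (r + 1)) + 1 := by omega
  rw [remMean, h1, law, mean_bind]
  refine mean_mono _ fun G hG => ?_
  obtain ⟨h2, h3⟩ := deficiency_of_mem_support hd hr (by omega) hG
  rw [remDeficiency_succ] at h3
  rw [mean_step]
  · exact h G h2 h3
  · apply addable_nonempty_of_lt hd
    have h4 : ((d * d : ℕ) : ℝ) < (2 * r : ℕ) := Nat.cast_lt.2 hdr
    have h5 := two_mul_le_remDeficiency d n r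
    have : ((d * d : ℕ) : ℝ) < deficiency d G := by
      rw [h3]; push_cast at h4 ⊢; linarith
    exact_mod_cast this

/-- The fraction of vertices of degree at most `d - k` when `r` steps remain. -/
noncomputable def remFrac {n : ℕ} (d k r : ℕ) (G : SimpleGraph (Fin n)) : ℝ :=
  frac d k (remDeficiency d n r) G

theorem remDeficiency_nonneg (d n r : ℕ) : 0 ≤ remDeficiency d n r := by
  rw [remDeficiency]; positivity

theorem remFrac_nonneg (r : ℕ) : 0 ≤ remFrac d k r G := frac_nonneg (remDeficiency_nonneg _ _ _)

theorem remFrac_anti (r : ℕ) {l : ℕ} (h : k ≤ l) : remFrac d l r G ≤ remFrac d k r G :=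
  frac_anti (remDeficiency_nonneg _ _ _) h

/-- A Young-type inequality, by cases on b ≤ a²/4. It splits the source in the drift of a^(2(m+1))
between its own damping and the damping of b^(m+1), which is why exponents double from level to
level. -/
theorem pow_mul_le_of_le {a b z : ℝ} (hb : 0 ≤ b) (hba : b ≤ a) (haz : a ≤ z) (m : ℕ) :
    a ^ (2 * m + 1) * b ≤ z * (a ^ (2 * (m + 1)) / 4 + 4 ^ m * b ^ (m + 1)) := by
  have ha := hb.trans hba
  have h1 : a ^ (2 * m + 1) * b ≤ z * (a ^ (2 * m) * b) := by
    rw [pow_succ]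
    have : 0 ≤ a ^ (2 * m) * b := by positivity
    nlinarith
  refine h1.trans (mul_le_mul_of_nonneg_left ?_ (ha.trans haz))
  by_cases h : b ≤ a ^ 2 / 4
  · have h2 : a ^ (2 * m) * b ≤ a ^ (2 * m) * (a ^ 2 / 4) :=
      mul_le_mul_of_nonneg_left h (by positivity)
    have h3 : a ^ (2 * m) * (a ^ 2 / 4) = a ^ (2 * (m + 1)) / 4 := by ring
    have h4 : 0 ≤ (4 : ℝ) ^ m * b ^ (m + 1) := by positivity
    linarith
  · have h2 : a ^ (2 * m) ≤ (4 * b) ^ m := by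
      rw [pow_mul]
      exact pow_le_pow_left₀ (by positivity) (by linarith) m
    have h3 : a ^ (2 * m) * b ≤ (4 * b) ^ m * b := mul_le_mul_of_nonneg_right h2 hb
    have h4 : (4 * b) ^ m * b = 4 ^ m * b ^ (m + 1) := by ring
    have h5 : 0 ≤ a ^ (2 * (m + 1)) / 4 := by positivity
    linarith

theorem remMean_pow_step_le (hd : 2 ≤ d) (hk : 2 ≤ k) (m : ℕ) : ∃ C : ℝ, 0 ≤ C ∧
    ∀ n r : ℕ, 4 * d ^ 2 ≤ r → r < d * n / 2 →
      remMean d n r (fun G => remFrac d k r G ^ (2 * (m + 1))) ≤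
        remMean d n (r + 1) (fun G => remFrac d k (r + 1) G ^ (2 * (m + 1))) -
        (1 / 3) * (remMean d n (r + 1)
          (fun G => remFrac d 2 (r + 1) G * remFrac d k (r + 1) G ^ (2 * (m + 1))) / r) +
        C * (remMean d n (r + 1)
          (fun G => remFrac d 2 (r + 1) G * remFrac d (k + 1) (r + 1) G ^ (m + 1)) / r) +
        C / r ^ 2 := by
  -- The first summand covers the source coefficient, the second the O(1/q²) error. The 1/3 in the
  -- statement comes from q ≤ 3r.
  refine ⟨4 * (2 * (m + 1)) * 4 ^ m + 4 * ((2 * (m + 1)) * d ^ 2 + (2 * (m + 1)) ^ 2),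
    by positivity, fun n r hr hrn => ?_⟩
  set C : ℝ := 4 * (2 * (m + 1)) * 4 ^ m + 4 * ((2 * (m + 1)) * d ^ 2 + (2 * (m + 1)) ^ 2) with hC
  have hd4 : 4 ≤ d ^ 2 := by nlinarith
  have hr1 : 1 ≤ r := by omega
  have hr0 : (0 : ℝ) < r := by exact_mod_cast hr1
  have hrd : (d : ℝ) ^ 2 ≤ r := by
    have : d ^ 2 ≤ r := by omega
    exact_mod_cast this
  have h := remMean_step_le (n := n) (r := r) (by omega : 1 ≤ d) hrn (by nlinarith)
    (f := fun G => remFrac d k r G ^ (2 * (m + 1)))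
    (g := fun G => remFrac d k (r + 1) G ^ (2 * (m + 1)) +
      ((-(1 / 3) / r) * (remFrac d 2 (r + 1) G * remFrac d k (r + 1) G ^ (2 * (m + 1))) +
      ((C / r) * (remFrac d 2 (r + 1) G * remFrac d (k + 1) (r + 1) G ^ (m + 1)) +
        C / r ^ 2))) ?_
  · unfold remMean at h ⊢
    rw [mean_add, mean_add, mean_add, mean_const, mean_mul_left, mean_mul_left] at h
    refine h.trans (le_of_eq ?_)
    ring
  · intro G hdeg hD
    have hq1 := two_mul_le_remDeficiency d n r
    have hq2 := remDeficiency_le d n hr1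
    have h1 := stepMean_frac_pow_le (by omega : 1 ≤ d) (by omega : 1 ≤ k)
      (q := remDeficiency d n r) (by linarith) hdeg hD (2 * m + 1)
    have hz0 : 0 ≤ remFrac d 2 (r + 1) G := remFrac_nonneg _
    have hb0 : 0 ≤ remFrac d (k + 1) (r + 1) G := remFrac_nonneg _
    have hba : remFrac d (k + 1) (r + 1) G ≤ remFrac d k (r + 1) G := remFrac_anti _ (by omega)
    have haz : remFrac d k (r + 1) G ≤ remFrac d 2 (r + 1) G := remFrac_anti _ hk
    have h2 := pow_mul_le_of_le hb0 hba haz m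
    simp only [remFrac] at *
    rw [remDeficiency_succ] at *
    generalize remDeficiency d n r = q at *
    generalize frac d 2 (q + 2) G = z at *
    generalize frac d (k + 1) (q + 2) G = b at *
    generalize frac d k (q + 2) G = a at *
    have ha0 := hb0.trans hba
    refine h1.trans ?_
    have hq0 : 0 < q := by linarith
    set N : ℝ := 2 * (m + 1) with hN
    have hN' : (((2 * m + 1 : ℕ) : ℝ) + 1) = N := by rw [hN]; push_cast; ring
    rw [hN']
    have e1 : (2 * m + 1 + 1) = 2 * (m + 1) := by ring
    rw [e1]
    have hN1 : 2 ≤ N := by rw [hN]; have : (0 : ℝ) ≤ m := Nat.cast_nonneg m; linarith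
    have h3 : N * a ^ (2 * m + 1) * (-(z * a) + 2 * b) ≤
        -(z * a ^ (2 * (m + 1))) + 2 * N * 4 ^ m * (z * b ^ (m + 1)) := by
      have e2 : N * a ^ (2 * m + 1) * (-(z * a) + 2 * b) =
        N * (-(z * a ^ (2 * (m + 1))) + 2 * (a ^ (2 * m + 1) * b)) := by ring
      rw [e2]
      have h4 : N * (-(z * a ^ (2 * (m + 1))) + 2 * (a ^ (2 * m + 1) * b)) ≤
        N * (-(z * a ^ (2 * (m + 1))) / 2 + 2 * 4 ^ m * (z * b ^ (m + 1))) := by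
        apply mul_le_mul_of_nonneg_left _ (by linarith)
        linarith
      have h5 : 0 ≤ z * a ^ (2 * (m + 1)) := by positivity
      nlinarith
    have i1 : 2 / q ≤ 1 / r := by rw [div_le_div_iff₀ hq0 hr0]; linarith
    have i2 : 1 / 3 / r ≤ 2 / q := by
      rw [div_div, div_le_div_iff₀ (by positivity) hq0]; linarith
    have i3 : 1 / q ^ 2 ≤ 1 / (r : ℝ) ^ 2 := by
      apply one_div_le_one_div_of_le (by positivity)
      exact pow_le_pow_left₀ hr0.le (by linarith) 2
    have h6 := mul_le_mul_of_nonneg_left h3 (by positivity : 0 ≤ 2 / q)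
    have t1 : 0 ≤ z * a ^ (2 * (m + 1)) := by positivity
    have t2 : 0 ≤ z * b ^ (m + 1) := by positivity
    have t3 : 2 * N * 4 ^ m ≤ C := by
      rw [hC]
      have : 0 ≤ N * 4 ^ m := by positivity
      have : 0 ≤ 4 * (N * (d : ℝ) ^ 2 + N ^ 2) := by positivity
      linarith
    have t4 : 4 * (N * (d : ℝ) ^ 2 + N ^ 2) ≤ C := by
      rw [hC]
      have : 0 ≤ 4 * N * 4 ^ m := by positivity
      linarith
    have h7 : 2 / q * (z * a ^ (2 * (m + 1))) ≥ 1 / 3 / r * (z * a ^ (2 * (m + 1))) :=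
      mul_le_mul_of_nonneg_right i2 t1
    have h8 : 2 / q * (2 * N * 4 ^ m * (z * b ^ (m + 1))) ≤ C / r * (z * b ^ (m + 1)) := by
      rw [← mul_assoc]
      apply mul_le_mul_of_nonneg_right _ t2
      calc 2 / q * (2 * N * 4 ^ m) ≤ 1 / r * C := by
            apply mul_le_mul i1 t3 (by positivity) (by positivity)
        _ = C / r := by ring
    have h9 : 4 * (N * (d : ℝ) ^ 2 + N ^ 2) / q ^ 2 ≤ C / r ^ 2 := by
      calc 4 * (N * (d : ℝ) ^ 2 + N ^ 2) / q ^ 2 =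
            4 * (N * (d : ℝ) ^ 2 + N ^ 2) * (1 / q ^ 2) := by ring
        _ ≤ C * (1 / r ^ 2) := by
            apply mul_le_mul t4 i3 (by positivity) (by positivity)
        _ = C / r ^ 2 := by ring
    have e3 : -(1 / 3) / (r : ℝ) * (z * a ^ (2 * (m + 1))) =
      -(1 / 3 / r * (z * a ^ (2 * (m + 1)))) := by ring
    rw [e3]
    linarith

end

/-! ### Telescoping through the hierarchy of powers. -/

section

variable {n d k : ℕ} {G : SimpleGraph (Fin n)}

theorem remMean_top_step_le (hd : 2 ≤ d) {n r : ℕ} (hr : 4 * d ^ 2 ≤ r) (hrn : r < d * n / 2) :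
    remMean d n r (remFrac d d r) ≤ remMean d n (r + 1) (remFrac d d (r + 1)) -
      (1 / 3) * (remMean d n (r + 1)
        (fun G => remFrac d 2 (r + 1) G * remFrac d d (r + 1) G) / r) + d ^ 2 / r ^ 2 := by
  have hd4 : 4 ≤ d ^ 2 := by nlinarith
  have hr1 : 1 ≤ r := by omega
  have hr0 : (0 : ℝ) < r := by exact_mod_cast hr1
  have hrd : (d : ℝ) ^ 2 ≤ r := by
    have : d ^ 2 ≤ r := by omega
    exact_mod_cast this
  have h := remMean_step_le (n := n) (r := r) (by omega : 1 ≤ d) hrn (by nlinarith)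
    (f := remFrac d d r)
    (g := fun G => remFrac d d (r + 1) G +
      ((-(1 / 3) / r) * (remFrac d 2 (r + 1) G * remFrac d d (r + 1) G) + d ^ 2 / r ^ 2)) ?_
  · unfold remMean at h ⊢
    rw [mean_add, mean_add, mean_const, mean_mul_left] at h
    refine h.trans (le_of_eq ?_)
    ring
  · intro G hdeg hD
    have hq1 := two_mul_le_remDeficiency d n r
    have hq2 := remDeficiency_le d n hr1
    have h1 := stepMean_frac_le (by omega : 1 ≤ d) (by omega : 1 ≤ d)
      (q := remDeficiency d n r) (by linarith) hD
    have h2 : frac d d (remDeficiency d n r + 2) G ≤ 1 :=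
      frac_le_one (by linarith) hD (by omega)
    have hz0 : 0 ≤ remFrac d 2 (r + 1) G := remFrac_nonneg _
    have ha0 : 0 ≤ remFrac d d (r + 1) G := remFrac_nonneg _
    rw [frac_eq_zero (Nat.lt_succ_self d)] at h1
    change stepMean d (frac d d (remDeficiency d n r)) G ≤ _
    simp only [remFrac] at *
    rw [remDeficiency_succ] at *
    generalize remDeficiency d n r = q at *
    generalize frac d 2 (q + 2) G = z at *
    generalize frac d d (q + 2) G = a at *
    refine h1.trans ?_
    have hq0 : 0 < q := by linarith
    have i2 : 1 / 3 / r ≤ 2 / q := by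
      rw [div_div, div_le_div_iff₀ (by positivity) hq0]; linarith
    have i3 : 4 / q ^ 2 ≤ 1 / (r : ℝ) ^ 2 := by
      rw [div_le_div_iff₀ (by positivity) (by positivity)]
      nlinarith
    have h7 : 2 / q * (z * a) ≥ 1 / 3 / r * (z * a) :=
      mul_le_mul_of_nonneg_right i2 (by positivity)
    have h9 : 4 / q ^ 2 * ((d : ℝ) ^ 2 * a) ≤ 1 / (r : ℝ) ^ 2 * (d ^ 2 * 1) := by
      apply mul_le_mul i3 _ (by positivity) (by positivity)
      exact mul_le_mul_of_nonneg_left h2 (by positivity)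
    have e1 : 2 / q * (-(z * a) + 2 * 0 + 2 * d ^ 2 * a / q) =
      -(2 / q * (z * a)) + 4 / q ^ 2 * (d ^ 2 * a) := by field_simp; ring
    have e2 : -(1 / 3) / (r : ℝ) * (z * a) = -(1 / 3 / r * (z * a)) := by ring
    have e3 : 1 / (r : ℝ) ^ 2 * (d ^ 2 * 1) = d ^ 2 / r ^ 2 := by ring
    rw [e1, e2, ← e3]
    linarith

/-- The errors C/r² telescope through 1/r² ≤ 2/r − 2/(r + 1). -/
theorem telescope_le {e i h : ℕ → ℝ} {c C : ℝ} (hC : 0 ≤ C) {L : ℕ} (hL : 1 ≤ L) {R : ℕ}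
    (hLR : L ≤ R)
    (hstep : ∀ r, L ≤ r → r < R → e r ≤ e (r + 1) - c * i r + C * h r + C / r ^ 2) :
    e L + c * ∑ r ∈ Finset.Ico L R, i r ≤
      e R + C * ∑ r ∈ Finset.Ico L R, h r + C * (2 / L) := by
  suffices H : e L + c * ∑ r ∈ Finset.Ico L R, i r ≤
      e R + C * ∑ r ∈ Finset.Ico L R, h r + C * (2 / L - 2 / R) by
    have : 0 ≤ C * (2 / (R : ℝ)) := by positivity
    linarith
  induction R, hLR using Nat.le_induction with
  | base => simp
  | succ R hR ih =>
    have h1 := ih fun r h1 h2 => hstep r h1 (by omega)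
    have h2 := hstep R hR (Nat.lt_succ_self R)
    rw [Finset.sum_Ico_succ_top hR, Finset.sum_Ico_succ_top hR]
    have hR1 : (1 : ℝ) ≤ R := by exact_mod_cast hL.trans hR
    have h3 : 1 / (R : ℝ) ^ 2 ≤ 2 / R - 2 / (R + 1) := by
      rw [div_sub_div _ _ (by positivity) (by positivity),
        div_le_div_iff₀ (by positivity) (by positivity)]
      nlinarith
    have h4 := mul_le_mul_of_nonneg_left h3 hC
    have h5 : C / (R : ℝ) ^ 2 = C * (1 / (R : ℝ) ^ 2) := by ring
    push_cast
    linarith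

theorem remFrac_le_one {r : ℕ} (hk : 1 ≤ k) (hr : 1 ≤ r)
    (h : (deficiency d G : ℝ) = remDeficiency d n r) : remFrac d k r G ≤ 1 := by
  refine frac_le_one ?_ h hk
  have := two_mul_le_remDeficiency d n r
  have : (1 : ℝ) ≤ r := by exact_mod_cast hr
  linarith

theorem remMean_pow_le_remMean (hd : 2 ≤ d) (hk : 2 ≤ k) {n r m : ℕ} (hm : 1 ≤ m)
    (hr : 4 * d ^ 2 ≤ r) (hrn : r ≤ d * n / 2) :
    remMean d n r (fun G => remFrac d k r G ^ m) ≤ remMean d n r (remFrac d 2 r) := by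
  refine remMean_mono (by omega) hrn (by nlinarith) fun G _ hD => ?_
  have h1 : remFrac d k r G ≤ 1 := remFrac_le_one (by omega) (by nlinarith) hD
  exact (pow_le_of_le_one (remFrac_nonneg r) h1 (by omega)).trans (remFrac_anti r hk)

theorem remMean_nonneg {n r : ℕ} {f : SimpleGraph (Fin n) → ℝ} (h : ∀ G, 0 ≤ f G) :
    0 ≤ remMean d n r f := mean_nonneg _ fun G _ => h G

/-- The top level k = d has no source, so telescoping bounds its total damping. That sum is the
total source for the next level, and the induction descends to k = 2. The bound keeps the mean at R,
so that it can be reapplied from a better starting time. -/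
theorem exists_remMean_pow_add_sum_le (hd : 2 ≤ d) (j : ℕ) (hj : j + 2 ≤ d) : ∃ C : ℝ, 0 ≤ C ∧
    ∀ n L R : ℕ, 4 * d ^ 2 ≤ L → L ≤ R → R ≤ d * n / 2 →
      remMean d n L (fun G => remFrac d (d - j) L G ^ 2 ^ j) +
        ∑ r ∈ Finset.Ico L R, remMean d n (r + 1)
          (fun G => remFrac d 2 (r + 1) G * remFrac d (d - j) (r + 1) G ^ 2 ^ j) / r ≤
      C * (remMean d n R (remFrac d 2 R) + 1 / L) := by
  have key : ∀ {x s y : ℝ}, 0 ≤ x → x + (1 / 3) * s ≤ y → x + s ≤ 3 * y := by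
    intro x s y hx h; linarith
  induction j with
  | zero =>
    refine ⟨3 * (1 + 2 * d ^ 2), by positivity, fun n L R hL hLR hR => ?_⟩
    have hL1 : 1 ≤ L := by nlinarith
    have h1 := telescope_le (e := fun r => remMean d n r (remFrac d d r))
      (i := fun r => remMean d n (r + 1)
        (fun G => remFrac d 2 (r + 1) G * remFrac d d (r + 1) G) / r) (h := fun _ => 0)
      (c := 1 / 3) (by positivity : (0 : ℝ) ≤ d ^ 2) hL1 hLR fun r h1 h2 => by
        have := remMean_top_step_le hd (n := n) (hL.trans h1) (by omega)
        simpa using this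
    have h2 := remMean_pow_le_remMean hd hd le_rfl (hL.trans hLR) hR
    simp only [pow_one] at h2
    change remMean d n R (remFrac d d R) ≤ _ at h2
    simp only [Nat.sub_zero, pow_zero, pow_one]
    have h0 : 0 ≤ remMean d n L (remFrac d d L) := remMean_nonneg fun G => remFrac_nonneg _
    have h3 := key h0 h1
    refine h3.trans ?_
    have hz : 0 ≤ remMean d n R (remFrac d 2 R) := remMean_nonneg fun G => remFrac_nonneg _
    have hLi : (0 : ℝ) ≤ 1 / L := by positivity
    have hd0 : (0 : ℝ) ≤ (d : ℝ) ^ 2 := by positivity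
    have e1 : (d : ℝ) ^ 2 * (2 / L) = 2 * d ^ 2 * (1 / L) := by ring
    simp only [Finset.sum_const_zero, mul_zero, add_zero, e1]
    nlinarith [mul_nonneg hd0 hz]
  | succ j ih =>
    obtain ⟨C1, hC1, h1⟩ := ih (by omega)
    obtain ⟨C2, hC2, h2⟩ := remMean_pow_step_le hd (by omega : 2 ≤ d - (j + 1)) (2 ^ j - 1)
    have em : 2 ^ j - 1 + 1 = 2 ^ j := Nat.sub_add_cancel Nat.one_le_two_pow
    have ek : d - (j + 1) + 1 = d - j := by omega
    rw [em, ek] at h2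
    have e2 : 2 * 2 ^ j = 2 ^ (j + 1) := by ring
    rw [e2] at h2
    refine ⟨3 * (1 + C2 * C1 + 2 * C2), by positivity, fun n L R hL hLR hR => ?_⟩
    have hL1 : 1 ≤ L := by nlinarith
    have h3 := telescope_le
      (e := fun r => remMean d n r (fun G => remFrac d (d - (j + 1)) r G ^ 2 ^ (j + 1)))
      (i := fun r => remMean d n (r + 1) (fun G => remFrac d 2 (r + 1) G *
        remFrac d (d - (j + 1)) (r + 1) G ^ 2 ^ (j + 1)) / r)
      (h := fun r => remMean d n (r + 1) (fun G => remFrac d 2 (r + 1) G *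
        remFrac d (d - j) (r + 1) G ^ 2 ^ j) / r)
      (c := 1 / 3) hC2 hL1 hLR fun r h4 h5 => h2 n r (hL.trans h4) (by omega)
    have h4 := h1 n L R hL hLR hR
    have h5 := remMean_pow_le_remMean hd (by omega : 2 ≤ d - (j + 1))
      (Nat.one_le_two_pow (n := j + 1)) (hL.trans hLR) hR
    have h0 : 0 ≤ remMean d n L (fun G => remFrac d (d - (j + 1)) L G ^ 2 ^ (j + 1)) :=
      remMean_nonneg fun G => pow_nonneg (remFrac_nonneg _) _
    have h0' : 0 ≤ remMean d n L (fun G => remFrac d (d - j) L G ^ 2 ^ j) :=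
      remMean_nonneg fun G => pow_nonneg (remFrac_nonneg _) _
    refine (key h0 h3).trans ?_
    have hz : 0 ≤ remMean d n R (remFrac d 2 R) := remMean_nonneg fun G => remFrac_nonneg _
    have hLi : (0 : ℝ) ≤ 1 / L := by positivity
    have h6 := mul_le_mul_of_nonneg_left ((le_add_of_nonneg_left h0').trans h4) hC2
    have e1 : C2 * (2 / (L : ℝ)) = 2 * C2 * (1 / L) := by ring
    rw [e1]
    nlinarith [mul_nonneg hC2 hz]

theorem tendsto_sum_one_div_nat_add (L : ℕ) :
    Tendsto (fun m => ∑ i ∈ Finset.range m, 1 / ((L + i : ℕ) : ℝ)) atTop atTop := by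
  have h : ¬ Summable fun i : ℕ => 1 / ((L + i : ℕ) : ℝ) := by
    have := (summable_nat_add_iff (f := fun i : ℕ => 1 / (i : ℝ)) L).not.2
      Real.not_summable_one_div_natCast
    simpa [add_comm] using this
  exact (not_summable_iff_tendsto_nat_atTop_of_nonneg fun i => by positivity).1 h

theorem tendsto_mul_div_two (hd : 2 ≤ d) : Tendsto (fun n : ℕ => d * n / 2) atTop atTop := by
  refine tendsto_atTop_mono (fun n => ?_) tendsto_id
  have : 2 * n ≤ d * n := Nat.mul_le_mul_right n hd
  simp only [id]
  omega

/-- Converts a small mean of z^(P+1) into a small mean of z. -/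
theorem le_add_pow_div {z δ : ℝ} (hz : 0 ≤ z) (hδ : 0 < δ) (P : ℕ) :
    z ≤ δ + z * z ^ P / δ ^ P := by
  by_cases h : z ≤ δ
  · have : 0 ≤ z * z ^ P / δ ^ P := by positivity
    linarith
  · have : z * 1 ≤ z * (z ^ P / δ ^ P) := by
      apply mul_le_mul_of_nonneg_left _ hz
      rw [one_le_div (by positivity)]
      exact pow_le_pow_left₀ hδ.le (not_le.1 h).le P
    rw [mul_div_assoc]
    linarith

theorem exists_eventually_remMean_pow_le (hd : 2 ≤ d) : ∃ C : ℝ, 0 ≤ C ∧ ∀ L : ℕ,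
    4 * d ^ 2 ≤ L → ∀ᶠ n in atTop,
      remMean d n L (fun G => remFrac d 2 L G ^ 2 ^ (d - 2)) ≤ C / L := by
  obtain ⟨C, hC, h⟩ := exists_remMean_pow_add_sum_le hd (d - 2) (by omega)
  rw [show d - (d - 2) = 2 by omega] at h
  set P := 2 ^ (d - 2) with hP
  refine ⟨2 * C, by positivity, fun L hL => ?_⟩
  have hL1 : 1 ≤ L := by nlinarith
  have hL0 : (0 : ℝ) < L := by exact_mod_cast hL1
  -- With ε = δ · δ^P, both terms of `le_add_pow_div` have mean at most δ, and δ + δ = 1/L.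
  set δ : ℝ := 1 / (2 * L) with hδ
  have hδ0 : 0 < δ := by positivity
  set ε : ℝ := δ * δ ^ P with hε
  have hε0 : 0 < ε := by positivity
  have hT := tendsto_mul_div_two hd
  have hTL := (tendsto_sub_atTop_nat L).comp hT
  filter_upwards [((tendsto_sum_one_div_nat_add L).comp hTL).eventually_gt_atTop (2 * C / ε),
    hT.eventually_ge_atTop L] with n hn hLn
  simp only [Function.comp_apply] at hn
  have h1 := h n L (d * n / 2) hL hLn le_rfl
  have hζ1 : remMean d n (d * n / 2) (remFrac d 2 (d * n / 2)) ≤ 1 := by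
    have : remMean d n (d * n / 2) (remFrac d 2 (d * n / 2)) ≤
        remMean d n (d * n / 2) (fun _ => 1) :=
      remMean_mono (by omega) le_rfl (by nlinarith) fun G _ hD =>
        remFrac_le_one (by omega) (by omega) hD
    exact this.trans (mean_const _ 1).le
  have hLi : 1 / (L : ℝ) ≤ 1 := by
    rw [div_le_one hL0]; exact_mod_cast hL1
  have h0 : 0 ≤ remMean d n L (fun G => remFrac d 2 L G ^ P) :=
    remMean_nonneg fun G => pow_nonneg (remFrac_nonneg _) _
  -- The summed damping over the whole run is at most 2C. If every mean exceeded ε, the divergence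
  -- of Σ 1/r would contradict this.
  obtain ⟨r, hr1, hr2⟩ : ∃ r ∈ Finset.Ico L (d * n / 2), remMean d n (r + 1)
      (fun G => remFrac d 2 (r + 1) G * remFrac d 2 (r + 1) G ^ P) ≤ ε := by
    by_contra! hcon
    have h2 : ε * ∑ i ∈ Finset.range (d * n / 2 - L), 1 / ((L + i : ℕ) : ℝ) ≤
        ∑ r ∈ Finset.Ico L (d * n / 2), remMean d n (r + 1)
          (fun G => remFrac d 2 (r + 1) G * remFrac d 2 (r + 1) G ^ P) / r := by
      rw [← Finset.sum_Ico_eq_sum_range (fun i : ℕ => 1 / (i : ℝ)), Finset.mul_sum]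
      refine Finset.sum_le_sum fun r hr => ?_
      rw [mul_one_div]
      exact div_le_div_of_nonneg_right (hcon r hr).le (Nat.cast_nonneg r)
    rw [div_lt_iff₀ hε0] at hn
    nlinarith
  rw [Finset.mem_Ico] at hr1
  have h3 : remMean d n (r + 1) (remFrac d 2 (r + 1)) ≤ 1 / L := by
    have h4 : remMean d n (r + 1) (remFrac d 2 (r + 1)) ≤ remMean d n (r + 1)
        (fun G => δ + 1 / δ ^ P * (remFrac d 2 (r + 1) G * remFrac d 2 (r + 1) G ^ P)) := by
      refine mean_mono _ fun G _ => ?_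
      refine (le_add_pow_div (remFrac_nonneg (r + 1)) hδ0 P).trans (le_of_eq ?_)
      ring
    unfold remMean at h4 hr2 ⊢
    rw [mean_add, mean_const, mean_mul_left] at h4
    have h5 := mul_le_mul_of_nonneg_left hr2 (by positivity : 0 ≤ 1 / δ ^ P)
    have h6 : 1 / δ ^ P * ε = δ := by rw [hε]; field_simp
    have h7 : 1 / (L : ℝ) = δ + δ := by rw [hδ]; field_simp; norm_num
    linarith
  -- Second use of the same estimate, now from time r + 1, where the mean of z_2 is at most 1/L
  -- instead of merely 1.
  have h4 := h n L (r + 1) hL (by omega) (by omega)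
  have h5 : 0 ≤ ∑ s ∈ Finset.Ico L (r + 1), remMean d n (s + 1)
          (fun G => remFrac d 2 (s + 1) G * remFrac d 2 (s + 1) G ^ P) / s :=
    Finset.sum_nonneg fun s _ => div_nonneg (remMean_nonneg fun G =>
      mul_nonneg (remFrac_nonneg _) (pow_nonneg (remFrac_nonneg _) _)) (Nat.cast_nonneg s)
  have h6 := mul_le_mul_of_nonneg_left (add_le_add_left h3 (1 / (L : ℝ))) hC
  have h7 : C * (1 / (L : ℝ) + 1 / L) = 2 * C / L := by ring
  linarith

end

/-! ### Low-degree vertices disappear before a fixed time. -/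

section

variable {n d k : ℕ} {G : SimpleGraph (Fin n)}

/-- The damping is discarded to make the recursion linear, hence closed in the means alone. -/
theorem remMean_remFrac_step_le (hd : 2 ≤ d) (hk : 2 ≤ k) {n r : ℕ} (hr : 4 * d ^ 2 ≤ r)
    (hrn : r < d * n / 2) :
    remMean d n r (remFrac d k r) ≤ remMean d n (r + 1) (remFrac d k (r + 1)) +
      (2 * remMean d n (r + 1) (remFrac d (k + 1) (r + 1)) +
        2 * d ^ 2 / r * remMean d n (r + 1) (remFrac d k (r + 1))) / r := by
  have hd4 : 4 ≤ d ^ 2 := by nlinarith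
  have hr1 : 1 ≤ r := by omega
  have hr0 : (0 : ℝ) < r := by exact_mod_cast hr1
  have hrd : (d : ℝ) ^ 2 ≤ r := by
    have : d ^ 2 ≤ r := by omega
    exact_mod_cast this
  have h := remMean_step_le (n := n) (r := r) (by omega : 1 ≤ d) hrn (by nlinarith)
    (f := remFrac d k r)
    (g := fun G => remFrac d k (r + 1) G + ((2 / r) * remFrac d (k + 1) (r + 1) G +
      (2 * d ^ 2 / r / r) * remFrac d k (r + 1) G)) ?_
  · unfold remMean at h ⊢
    rw [mean_add, mean_add, mean_mul_left, mean_mul_left] at h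
    refine h.trans (le_of_eq ?_)
    ring
  · intro G hdeg hD
    have hq1 := two_mul_le_remDeficiency d n r
    have h1 := stepMean_frac_le (by omega : 1 ≤ d) (by omega : 1 ≤ k)
      (q := remDeficiency d n r) (by linarith) hD
    have hz0 : 0 ≤ remFrac d 2 (r + 1) G := remFrac_nonneg _
    have ha0 : 0 ≤ remFrac d k (r + 1) G := remFrac_nonneg _
    have hb0 : 0 ≤ remFrac d (k + 1) (r + 1) G := remFrac_nonneg _
    change stepMean d (frac d k (remDeficiency d n r)) G ≤ _
    simp only [remFrac] at *
    rw [remDeficiency_succ] at *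
    generalize remDeficiency d n r = q at *
    generalize frac d 2 (q + 2) G = z at *
    generalize frac d (k + 1) (q + 2) G = b at *
    generalize frac d k (q + 2) G = a at *
    refine h1.trans ?_
    have hq0 : 0 < q := by linarith
    have i1 : 2 / q ≤ 1 / r := by rw [div_le_div_iff₀ hq0 hr0]; linarith
    have h2 : -(z * a) + 2 * b + 2 * (d : ℝ) ^ 2 * a / q ≤ 2 * b + 2 * d ^ 2 * a / r := by
      have h3 : 2 * (d : ℝ) ^ 2 * a / q ≤ 2 * d ^ 2 * a / r :=
        div_le_div_of_nonneg_left (by positivity) hr0 (by linarith)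
      have : 0 ≤ z * a := by positivity
      linarith
    have h3 := mul_le_mul_of_nonneg_left h2 (by positivity : 0 ≤ 2 / q)
    have h4 := mul_le_mul_of_nonneg_right i1
      (by positivity : 0 ≤ 2 * b + 2 * (d : ℝ) ^ 2 * a / r)
    have h5 : 1 / (r : ℝ) * (2 * b + 2 * d ^ 2 * a / r) =
      2 / r * b + 2 * d ^ 2 / r / r * a := by ring
    linarith

/-- A weighted sum of the expected fractions of vertices of degree at most `d - 2`, `d - 3`, …. -/
noncomputable def weightedMean (lam : ℝ) (d n r : ℕ) : ℝ :=
  ∑ i ∈ Finset.range d, lam ^ i * remMean d n r (remFrac d (i + 2) r)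

theorem weightedMean_nonneg {lam : ℝ} (hl : 0 ≤ lam) (d n r : ℕ) : 0 ≤ weightedMean lam d n r :=
  Finset.sum_nonneg fun _ _ => mul_nonneg (pow_nonneg hl _) (remMean_nonneg fun _ => remFrac_nonneg _)

theorem remMean_le_weightedMean {lam : ℝ} (hl : 0 ≤ lam) (hd : 1 ≤ d) (n r : ℕ) :
    remMean d n r (remFrac d 2 r) ≤ weightedMean lam d n r := by
  have h := Finset.single_le_sum (f := fun i => lam ^ i * remMean d n r (remFrac d (i + 2) r))
    (fun _ _ => mul_nonneg (pow_nonneg hl _) (remMean_nonneg fun _ => remFrac_nonneg _))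
    (Finset.mem_range.2 (by omega : 0 < d))
  simpa [weightedMean] using h

theorem weightedMean_le {lam : ℝ} (hl : 0 ≤ lam) (d n r : ℕ) :
    weightedMean lam d n r ≤
      (∑ i ∈ Finset.range d, lam ^ i) * remMean d n r (remFrac d 2 r) := by
  rw [weightedMean, Finset.sum_mul]
  refine Finset.sum_le_sum fun i _ => mul_le_mul_of_nonneg_left ?_ (pow_nonneg hl _)
  exact mean_mono _ fun G _ => remFrac_anti r (by omega)

/-- The geometric weights make the sources, shifted by one index, cost only a fraction 1/`lam` of
the whole sum. A large `lam` therefore makes the growth exponent as small as desired. -/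
theorem weightedMean_step_le {lam : ℝ} (hl : 0 < lam) (hd : 2 ≤ d) {n r : ℕ}
    (hr : 4 * d ^ 2 ≤ r) (hrn : r < d * n / 2) :
    weightedMean lam d n r ≤
      weightedMean lam d n (r + 1) * (1 + (2 / lam + 2 * d ^ 2 / r) / r) := by
  have h1 : weightedMean lam d n r ≤ weightedMean lam d n (r + 1) +
      (2 * (∑ i ∈ Finset.range d, lam ^ i * remMean d n (r + 1) (remFrac d (i + 2 + 1) (r + 1))) +
        2 * d ^ 2 / r * weightedMean lam d n (r + 1)) / r := by
    simp only [weightedMean, Finset.mul_sum, ← Finset.sum_add_distrib, Finset.sum_div]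
    refine Finset.sum_le_sum fun i _ => ?_
    have := mul_le_mul_of_nonneg_left
      (remMean_remFrac_step_le hd (by omega : 2 ≤ i + 2) hr hrn) (pow_nonneg hl.le i)
    refine this.trans (le_of_eq ?_)
    ring
  have h2 : lam * (∑ i ∈ Finset.range d,
      lam ^ i * remMean d n (r + 1) (remFrac d (i + 2 + 1) (r + 1))) ≤
      weightedMean lam d n (r + 1) := by
    have h3 : ∑ i ∈ Finset.range (d + 1), lam ^ i * remMean d n (r + 1) (remFrac d (i + 2) (r + 1))
        = weightedMean lam d n (r + 1) := by
      rw [Finset.sum_range_succ, weightedMean]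
      -- Extending the range by one adds a zero term, so the index shift loses only the nonnegative
      -- term i = 0.
      have : remFrac (n := n) d (d + 2) (r + 1) = fun _ => 0 := by
        funext G; exact frac_eq_zero (by omega)
      rw [this, remMean, mean_const]
      simp
    rw [Finset.sum_range_succ'] at h3
    have h4 : 0 ≤ remMean d n (r + 1) (remFrac d 2 (r + 1)) := remMean_nonneg fun _ => remFrac_nonneg _
    rw [Finset.mul_sum, ← h3]
    have h5 : ∀ i, lam * (lam ^ i * remMean d n (r + 1) (remFrac d (i + 2 + 1) (r + 1))) =
      lam ^ (i + 1) * remMean d n (r + 1) (remFrac d (i + 1 + 2) (r + 1)) := by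
      intro i
      rw [pow_succ, show i + 2 + 1 = i + 1 + 2 by ring]
      ring
    rw [Finset.sum_congr rfl fun i _ => h5 i]
    simpa using h4
  have h3 : ∑ i ∈ Finset.range d, lam ^ i * remMean d n (r + 1) (remFrac d (i + 2 + 1) (r + 1)) ≤
      weightedMean lam d n (r + 1) / lam := by
    rw [le_div_iff₀ hl]; linarith
  refine h1.trans ?_
  have h4 : (2 * (∑ i ∈ Finset.range d,
      lam ^ i * remMean d n (r + 1) (remFrac d (i + 2 + 1) (r + 1))) +
        2 * d ^ 2 / r * weightedMean lam d n (r + 1)) / r ≤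
      (2 * (weightedMean lam d n (r + 1) / lam) +
        2 * d ^ 2 / r * weightedMean lam d n (r + 1)) / r :=
    div_le_div_of_nonneg_right (by linarith) (Nat.cast_nonneg r)
  refine (add_le_add_right h4 _).trans (le_of_eq ?_)
  ring

theorem one_add_pow_le {P r : ℕ} (hP : 1 ≤ P) (hr : 1 ≤ r) :
    (1 + 1 / (4 * P) / r : ℝ) ^ (2 * P) ≤ 1 + 1 / r := by
  have hP0 : (1 : ℝ) ≤ P := by exact_mod_cast hP
  have hr0 : (1 : ℝ) ≤ r := by exact_mod_cast hr
  have h1 : (1 + 1 / (4 * P) / r : ℝ) ≤ Real.exp (1 / (4 * P) / r) := by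
    have := Real.add_one_le_exp (1 / (4 * P) / r : ℝ); linarith
  have h2 : (1 + 1 / (4 * P) / r : ℝ) ^ (2 * P) ≤ Real.exp (1 / (2 * r)) := by
    refine (pow_le_pow_left₀ (by positivity) h1 _).trans (le_of_eq ?_)
    rw [← Real.exp_nat_mul]
    congr 1
    push_cast
    field_simp
    norm_num
  refine h2.trans ?_
  have h3 : |(1 / (2 * r) : ℝ)| ≤ 1 := by
    rw [abs_of_nonneg (by positivity), div_le_one (by positivity)]
    linarith
  have h4 := (abs_le.1 (Real.abs_exp_sub_one_le h3)).2
  rw [abs_of_nonneg (by positivity)] at h4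
  have h5 : 2 * (1 / (2 * (r : ℝ))) = 1 / r := by field_simp
  linarith

/-- The weight 16P and the bound r ≥ 16Pd² keep each of the two growth terms within 1/(8P). The
2P-th power then grows per step by at most 1 + 1/L = (L + 1)/L, which the factor L compensates. -/
theorem mul_weightedMean_pow_le (hd : 2 ≤ d) {P : ℕ} (hP : 1 ≤ P) {n r L : ℕ}
    (hr : 16 * P * d ^ 2 ≤ r) (hrL : r ≤ L) (hL : L ≤ d * n / 2) :
    r * weightedMean (16 * P) d n r ^ (2 * P) ≤ L * weightedMean (16 * P) d n L ^ (2 * P) := by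
  have hP0 : (1 : ℝ) ≤ P := by exact_mod_cast hP
  induction L, hrL using Nat.le_induction with
  | base => rfl
  | succ L hrL' ih =>
    refine (ih (by omega)).trans ?_
    have hrL : 16 * P * d ^ 2 ≤ L := hr.trans hrL'
    have hd1 : 1 ≤ d ^ 2 := Nat.one_le_pow _ _ (by omega)
    have hL4 : 4 * d ^ 2 ≤ L := by nlinarith
    have hL1 : 1 ≤ L := by nlinarith
    have hL0 : (1 : ℝ) ≤ L := by exact_mod_cast hL1
    have h1 := weightedMean_step_le (lam := 16 * P) (by positivity) hd hL4 (by omega : L < d * n / 2)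
    have h0 := weightedMean_nonneg (lam := 16 * P) (by positivity) d n (L + 1)
    have h2 : (2 / (16 * P) + 2 * d ^ 2 / L : ℝ) ≤ 1 / (4 * P) := by
      have h3 : (2 * d ^ 2 / L : ℝ) ≤ 1 / (8 * P) := by
        rw [div_le_div_iff₀ (by positivity) (by positivity)]
        have : (16 * P * d ^ 2 : ℝ) ≤ L := by exact_mod_cast hrL
        linarith
      have h4 : (2 / (16 * P) : ℝ) = 1 / (8 * P) := by field_simp; norm_num
      have h5 : (1 / (4 * P) : ℝ) = 1 / (8 * P) + 1 / (8 * P) := by field_simp; norm_num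
      linarith
    have h3 : weightedMean (16 * P) d n L ≤
        weightedMean (16 * P) d n (L + 1) * (1 + 1 / (4 * P) / L) := by
      refine h1.trans (mul_le_mul_of_nonneg_left ?_ h0)
      have := div_le_div_of_nonneg_right h2 (Nat.cast_nonneg (α := ℝ) L)
      linarith
    have h4 := pow_le_pow_left₀ (weightedMean_nonneg (by positivity) d n L) h3 (2 * P)
    rw [mul_pow] at h4
    have h5 := h4.trans (mul_le_mul_of_nonneg_left (one_add_pow_le hP hL1) (pow_nonneg h0 _))
    have h6 := mul_le_mul_of_nonneg_left h5 (Nat.cast_nonneg (α := ℝ) L)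
    refine h6.trans (le_of_eq ?_)
    push_cast
    field_simp

theorem tendsto_remMean_remFrac (hd : 2 ≤ d) {r : ℕ} (hr : 16 * 2 ^ (d - 2) * d ^ 2 ≤ r) :
    Tendsto (fun n => remMean d n r (remFrac d 2 r)) atTop (𝓝 0) := by
  obtain ⟨C, hC, h⟩ := exists_eventually_remMean_pow_le hd
  set P := 2 ^ (d - 2) with hP
  have hP1 : 1 ≤ P := Nat.one_le_two_pow
  have hd1 : 1 ≤ d ^ 2 := Nat.one_le_pow _ _ (by omega)
  have hr4 : 4 * d ^ 2 ≤ r := by nlinarith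
  have hr1 : 1 ≤ r := by nlinarith
  have hr0 : (1 : ℝ) ≤ r := by exact_mod_cast hr1
  set S := ∑ i ∈ Finset.range d, (16 * P : ℝ) ^ i with hS
  have hS0 : 0 ≤ S := Finset.sum_nonneg fun i _ => by positivity
  refine tendsto_order.2 ⟨fun a ha => Eventually.of_forall fun n =>
    ha.trans_le (remMean_nonneg fun _ => remFrac_nonneg _), fun ε hε => ?_⟩
  -- The estimates below give θ^(2P) ≤ S^(2P) C²/L. Here L is fixed first, and only then is n taken
  -- large.
  obtain ⟨L, hL⟩ := exists_nat_gt (max (r : ℝ) (S ^ (2 * P) * C ^ 2 / ε ^ (2 * P)))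
  have hrL : (r : ℝ) < L := (le_max_left _ _).trans_lt hL
  have hLε := (le_max_right _ _).trans_lt hL
  rw [div_lt_iff₀ (by positivity)] at hLε
  have hrL' : r < L := by exact_mod_cast hrL
  filter_upwards [h L (by omega), (tendsto_mul_div_two hd).eventually_ge_atTop L] with n h1 hLn
  have h2 := mul_weightedMean_pow_le hd hP1 hr hrL'.le hLn
  have hl : (0 : ℝ) ≤ 16 * P := by positivity
  set θ := remMean d n r (remFrac d 2 r) with hθ
  set η := remMean d n L (remFrac d 2 L) with hη
  have hθ0 : 0 ≤ θ := remMean_nonneg fun _ => remFrac_nonneg _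
  have hη0 : 0 ≤ η := remMean_nonneg fun _ => remFrac_nonneg _
  have h3 : η ^ P ≤ C / L :=
    (pow_mean_le _ (fun _ => remFrac_nonneg _) P).trans h1
  have hL0 : (0 : ℝ) < L := by linarith
  have h4 : weightedMean (16 * P) d n L ^ (2 * P) ≤ S ^ (2 * P) * (C / L) ^ 2 := by
    refine (pow_le_pow_left₀ (weightedMean_nonneg hl d n L) (weightedMean_le hl d n L) _).trans ?_
    rw [mul_pow, mul_comm 2 P, pow_mul η]
    apply mul_le_mul_of_nonneg_left _ (by positivity)
    exact pow_le_pow_left₀ (by positivity) h3 2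
  have h5 : θ ^ (2 * P) ≤ weightedMean (16 * P) d n r ^ (2 * P) :=
    pow_le_pow_left₀ hθ0 (remMean_le_weightedMean hl (by omega) n r) _
  have h6 : θ ^ (2 * P) * L ≤ S ^ (2 * P) * C ^ 2 := by
    have h7 : θ ^ (2 * P) ≤ L * (S ^ (2 * P) * (C / L) ^ 2) := by
      have : θ ^ (2 * P) ≤ r * weightedMean (16 * P) d n r ^ (2 * P) := by
        have : 0 ≤ weightedMean (16 * P) d n r ^ (2 * P) := pow_nonneg (weightedMean_nonneg hl _ _ _) _
        nlinarith
      exact (this.trans h2).trans (mul_le_mul_of_nonneg_left h4 hL0.le)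
    calc θ ^ (2 * P) * L ≤ L * (S ^ (2 * P) * (C / L) ^ 2) * L :=
          mul_le_mul_of_nonneg_right h7 hL0.le
      _ = S ^ (2 * P) * C ^ 2 := by field_simp
  refine lt_of_pow_lt_pow_left₀ (2 * P) hε.le ?_
  nlinarith

/-! ### Critical pairs disappear before a fixed time. -/

/-- The number of critical pairs, divided by the deficiency, when `r` steps remain. -/
noncomputable def remCritical {n : ℕ} (d r : ℕ) (G : SimpleGraph (Fin n)) : ℝ :=
  ((criticalPairs d G).card : ℝ) / remDeficiency d n r

theorem remCritical_nonneg (r : ℕ) : 0 ≤ remCritical d r G :=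
  div_nonneg (Nat.cast_nonneg _) (remDeficiency_nonneg _ _ _)

theorem remMean_remCritical_step_le (hd : 2 ≤ d) {n r : ℕ} (hr : 4 * d ^ 2 ≤ r)
    (hrn : r < d * n / 2) :
    remMean d n r (remCritical d r) ≤
      (1 - 1 / (3 * r)) * remMean d n (r + 1) (remCritical d (r + 1)) +
        3 * d ^ 2 / r * remMean d n (r + 1) (remFrac d 2 (r + 1)) := by
  have hd4 : 4 ≤ d ^ 2 := by nlinarith
  have hr1 : 1 ≤ r := by omega
  have hr0 : (0 : ℝ) < r := by exact_mod_cast hr1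
  have hrd : 4 * (d : ℝ) ^ 2 ≤ r := by exact_mod_cast hr
  have h := remMean_step_le (n := n) (r := r) (by omega : 1 ≤ d) hrn (by nlinarith)
    (f := remCritical d r)
    (g := fun G => (1 - 1 / (3 * r)) * remCritical d (r + 1) G +
      (3 * d ^ 2 / r) * remFrac d 2 (r + 1) G) ?_
  · unfold remMean at h ⊢
    rwa [mean_add, mean_mul_left, mean_mul_left] at h
  · intro G hdeg hD
    have hq1 := two_mul_le_remDeficiency d n r
    have hq2 := remDeficiency_le d n hr1
    have h1 := stepMean_criticalPairs_le (by omega : 1 ≤ d) hdeg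
      (q := remDeficiency d n r) (by linarith) hD
    have hz0 : 0 ≤ remFrac d 2 (r + 1) G := remFrac_nonneg _
    have ha0 : 0 ≤ remCritical d (r + 1) G := remCritical_nonneg _
    change stepMean d (fun H => ((criticalPairs d H).card : ℝ) / remDeficiency d n r) G ≤ _
    simp only [remFrac, remCritical] at *
    rw [remDeficiency_succ] at *
    generalize remDeficiency d n r = q at *
    generalize frac d 2 (q + 2) G = z at *
    generalize ((criticalPairs d G).card : ℝ) / (q + 2) = a at *
    refine h1.trans ?_
    have hq0 : 0 < q := by linarith
    have i1 : 1 / (3 * (r : ℝ)) ≤ 1 / q := one_div_le_one_div_of_le hq0 hq2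
    have i2 : 6 * (d : ℝ) ^ 2 * z / q ≤ 3 * d ^ 2 / r * z := by
      rw [div_mul_eq_mul_div, div_le_div_iff₀ hq0 hr0]
      have : 0 ≤ 3 * (d : ℝ) ^ 2 * z := by positivity
      nlinarith
    nlinarith

theorem remMean_remCritical_le (hd : 2 ≤ d) {n r : ℕ} (hr : 4 * d ^ 2 ≤ r)
    (hrn : r ≤ d * n / 2) : remMean d n r (remCritical d r) ≤ d := by
  have h : remMean d n r (remCritical d r) ≤ remMean d n r (fun _ => (d : ℝ)) := by
    refine remMean_mono (by omega) hrn (by nlinarith) fun G hdeg hD => ?_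
    have h1 := card_criticalPairs_le hdeg
    have h2 := card_add_card_le_deficiency (d := d) (G := G)
    have h3 : (criticalPairs d G).card ≤ d * deficiency d G :=
      h1.trans (Nat.mul_le_mul_left d (by omega))
    refine div_le_of_le_mul₀ (remDeficiency_nonneg _ _ _) (Nat.cast_nonneg d) ?_
    rw [← hD]
    exact_mod_cast h3
  exact h.trans (mean_const _ _).le

theorem tendsto_prod_one_sub (r : ℕ) (hr : 1 ≤ r) :
    Tendsto (fun m => ∏ i ∈ Finset.range m, (1 - 1 / (3 * ((r + i : ℕ) : ℝ)))) atTop (𝓝 0) := by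
  have hpos : ∀ i : ℕ, (1 : ℝ) ≤ ((r + i : ℕ) : ℝ) := fun i => by
    exact_mod_cast (by omega : 1 ≤ r + i)
  have h1 : Tendsto (fun m => Real.exp (-((1 / 3) *
      ∑ i ∈ Finset.range m, 1 / ((r + i : ℕ) : ℝ)))) atTop (𝓝 0) :=
    Real.tendsto_exp_neg_atTop_nhds_zero.comp
      ((tendsto_sum_one_div_nat_add r).const_mul_atTop (by norm_num))
  have hn : ∀ i : ℕ, 0 ≤ 1 - 1 / (3 * ((r + i : ℕ) : ℝ)) := fun i => by
    rw [sub_nonneg, div_le_one (by linarith [hpos i])]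
    linarith [hpos i]
  refine squeeze_zero (fun m => Finset.prod_nonneg fun i _ => hn i) (fun m => ?_) h1
  rw [Finset.mul_sum, ← Finset.sum_neg_distrib, Real.exp_sum]
  refine Finset.prod_le_prod (fun i _ => hn i) fun i _ => ?_
  have h2 := Real.add_one_le_exp (-(1 / 3 * (1 / ((r + i : ℕ) : ℝ))))
  have h3 : 1 / 3 * (1 / ((r + i : ℕ) : ℝ)) = 1 / (3 * ((r + i : ℕ) : ℝ)) := by
    rw [div_mul_div_comm, one_mul]
  rw [h3] at h2 ⊢
  linarith

/-- Iterates the contraction over the m steps leading to r, starting from the crude bound d. With m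
and r fixed there are finitely many source terms, each tending to 0. -/
theorem eventually_remMean_remCritical_le (hd : 2 ≤ d) (m : ℕ) :
    ∀ r : ℕ, 16 * 2 ^ (d - 2) * d ^ 2 ≤ r → ∀ ε > 0, ∀ᶠ n in atTop,
      remMean d n r (remCritical d r) ≤
        (∏ i ∈ Finset.range m, (1 - 1 / (3 * ((r + i : ℕ) : ℝ)))) * d + ε := by
  have hP1 : 1 ≤ 2 ^ (d - 2) := Nat.one_le_two_pow
  have hd1 : 1 ≤ d ^ 2 := Nat.one_le_pow _ _ (by omega)
  induction m with
  | zero =>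
    intro r hr ε hε
    filter_upwards [(tendsto_mul_div_two hd).eventually_ge_atTop r] with n hn
    have := remMean_remCritical_le hd (by nlinarith) hn
    simp only [Finset.range_zero, Finset.prod_empty]
    linarith
  | succ m ih =>
    intro r hr ε hε
    have hr4 : 4 * d ^ 2 ≤ r := by nlinarith
    have hr1 : 1 ≤ r := by nlinarith
    have hr0 : (1 : ℝ) ≤ r := by exact_mod_cast hr1
    have hζ := (tendsto_remMean_remFrac hd (r := r + 1) (by omega)).const_mul
      (3 * (d : ℝ) ^ 2 / r)
    rw [mul_zero] at hζ
    filter_upwards [(tendsto_mul_div_two hd).eventually_gt_atTop r,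
      ih (r + 1) (by omega) (ε / 2) (by linarith),
      hζ.eventually (gt_mem_nhds (by linarith : 0 < ε / 2))] with n hn h1 h2
    have h3 := remMean_remCritical_step_le hd hr4 hn
    rw [Finset.prod_range_succ']
    have h4 : ∏ i ∈ Finset.range m, (1 - 1 / (3 * ((r + (i + 1) : ℕ) : ℝ))) =
        ∏ i ∈ Finset.range m, (1 - 1 / (3 * ((r + 1 + i : ℕ) : ℝ))) :=
      Finset.prod_congr rfl fun i _ => by rw [show r + (i + 1) = r + 1 + i by ring]
    rw [h4, add_zero]
    have h5 : 0 ≤ 1 - 1 / (3 * (r : ℝ)) := by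
      rw [sub_nonneg, div_le_one (by linarith)]; linarith
    have h6 : 1 - 1 / (3 * (r : ℝ)) ≤ 1 := by
      have : 0 ≤ 1 / (3 * (r : ℝ)) := by positivity
      linarith
    have h7 := mul_le_mul_of_nonneg_left h1 h5
    nlinarith

theorem tendsto_remMean_remCritical (hd : 2 ≤ d) {r : ℕ} (hr : 16 * 2 ^ (d - 2) * d ^ 2 ≤ r) :
    Tendsto (fun n => remMean d n r (remCritical d r)) atTop (𝓝 0) := by
  have hP1 : 1 ≤ 2 ^ (d - 2) := Nat.one_le_two_pow
  have hd1 : 1 ≤ d ^ 2 := Nat.one_le_pow _ _ (by omega)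
  refine tendsto_order.2 ⟨fun a ha => Eventually.of_forall fun n =>
    ha.trans_le (remMean_nonneg fun _ => remCritical_nonneg _), fun ε hε => ?_⟩
  have h1 := (tendsto_prod_one_sub r (by nlinarith)).mul_const (d : ℝ)
  rw [zero_mul] at h1
  obtain ⟨m, hm⟩ := (h1.eventually (gt_mem_nhds (by linarith : 0 < ε / 2))).exists
  filter_upwards [eventually_remMean_remCritical_le hd m r hr (ε / 2) (by linarith)] with n hn
  linarith

/-! ### Good graphs, and the conclusion. -/

/-- All degrees are at least `d - 1`, and no two vertices of degree `d - 1` are adjacent. -/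
def IsGood {n : ℕ} (d : ℕ) (G : SimpleGraph (Fin n)) : Prop :=
  deficient d 2 G = ∅ ∧ criticalPairs d G = ∅

theorem IsGood.addEdge (hG : IsGood d G) (hdeg : ∀ v, G.degree v ≤ d) {e : Sym2 (Fin n)}
    (he : e ∈ addable d G) : IsGood d (addEdge G e) := by
  have h1 := card_deficient_addEdge (k := 2) he
  have h2 := card_criticalPairs_addEdge hdeg he
  rw [hG.1, Finset.card_empty] at h1
  rw [hG.1, hG.2] at h2
  simp only [Finset.filter_empty, Finset.card_empty, mul_zero, add_zero] at h2
  exact ⟨Finset.card_eq_zero.1 (by omega), Finset.card_eq_zero.1 (by omega)⟩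

theorem IsGood.isSaturated (hG : IsGood d G) (hdeg : ∀ v, G.degree v ≤ d)
    (hA : addable d G = ∅) : IsSaturated d G := by
  by_cases h : ∀ v, G.degree v = d
  · left
    intro v
    convert h v
  · right
    push Not at h
    obtain ⟨v, hv⟩ := h
    have hlow : ∀ w, d < G.degree w + 2 := fun w => by
      by_contra! hw
      have := mem_deficient.2 hw
      rw [hG.1] at this
      simp at this
    refine ⟨v, ?_, fun w hw => ?_⟩
    · have := hlow v
      have := hdeg v
      omega
    · by_contra hw'
      have hv1 := hlow v
      have hv2 := hdeg v
      have hw1 := hlow w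
      have hw2 := hdeg w
      by_cases hadj : G.Adj v w
      · have : (v, w) ∈ criticalPairs d G := by
          simp only [criticalPairs, Finset.mem_filter, Finset.mem_univ, true_and]
          exact ⟨hadj, by omega, by omega⟩
        rw [hG.2] at this
        simp at this
      · have : s(v, w) ∈ addable d G := by
          rw [mem_addable]
          refine ⟨by simpa using hw.symm, by simpa using hadj, fun x hx => ?_⟩
          rcases Sym2.mem_iff.1 hx with rfl | rfl <;> omega
        rw [hA] at this
        simp at this

/-- The probability of an event, as an expectation. -/
noncomputable def prob {α : Type*} [Fintype α] (p : PMF α) (s : α → Prop) : ℝ :=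
  mean p fun a => if s a then 1 else 0

theorem prob_isGood_mono (d n : ℕ) : Monotone fun s => prob (law d n s) (IsGood d) := by
  refine monotone_nat_of_le_succ fun s => ?_
  simp only [prob]
  rw [law, mean_bind]
  refine mean_mono _ fun G hG => ?_
  split_ifs with h
  · refine (mean_const (step d G) 1).ge.trans (mean_mono _ fun H hH => ?_)
    have hgood : IsGood d H := by
      unfold step at hH
      split_ifs at hH with hne
      · simp only [PMF.mem_support_map_iff, PMF.mem_support_uniformOfFinset_iff] at hH
        obtain ⟨e, he, rfl⟩ := hH
        exact h.addEdge (law_invariant d n s G hG).1 he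
      · simp only [PMF.support_pure, Set.mem_singleton_iff] at hH
        rwa [hH]
    rw [if_pos hgood]
  · exact mean_nonneg _ fun H _ => by split_ifs <;> norm_num

theorem prob_isGood_le_toReal (d n : ℕ) :
    prob (final d n) (IsGood d) ≤ (probSaturates d n).toReal := by
  have h : (probSaturates d n).toReal = prob (final d n) (IsSaturated d) := by
    rw [probSaturates, PMF.toOuterMeasure_apply_fintype, ENNReal.toReal_sum]
    · refine Finset.sum_congr rfl fun G _ => ?_
      by_cases hG : IsSaturated d G <;> simp [hG]
    · intro G _
      by_cases hG : IsSaturated d G <;> simp [hG, PMF.apply_ne_top]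
  rw [h]
  refine mean_mono _ fun G hG => ?_
  by_cases h1 : IsGood d G
  · rw [if_pos h1, if_pos (h1.isSaturated (law_invariant d n _ G hG).1
      (addable_eq_empty_of_mem_support_final d n G hG))]
  · rw [if_neg h1]
    split_ifs <;> norm_num

/-- Markov's inequality: if the graph is not good, the two integer counts sum to at least 1, and the
normalising `remDeficiency` is at most 3r. -/
theorem one_sub_le_prob_isGood {r : ℕ} (hd : 2 ≤ d) (hr : 4 * d ^ 2 ≤ r) :
    1 - 3 * r * (remMean d n r (remFrac d 2 r) + remMean d n r (remCritical d r)) ≤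
      prob (law d n (d * n / 2 - r)) (IsGood d) := by
  have hr1 : 1 ≤ r := by nlinarith
  have hr0 : (1 : ℝ) ≤ r := by exact_mod_cast hr1
  have hq1 := two_mul_le_remDeficiency d n r
  have hq2 := remDeficiency_le d n hr1
  have h : mean (law d n (d * n / 2 - r)) (fun _ => 1) ≤ mean (law d n (d * n / 2 - r))
      (fun G => (if IsGood d G then 1 else 0) +
        (3 * r) * (remFrac d 2 r G + remCritical d r G)) := by
    refine mean_mono _ fun G _ => ?_
    have hz0 : 0 ≤ remFrac d 2 r G := remFrac_nonneg _
    have ha0 : 0 ≤ remCritical d r G := remCritical_nonneg _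
    split_ifs with hG
    · have : 0 ≤ 3 * (r : ℝ) * (remFrac d 2 r G + remCritical d r G) := by positivity
      linarith
    · have h1 : 1 ≤ (deficient d 2 G).card + (criticalPairs d G).card := by
        by_contra! h1
        exact hG ⟨Finset.card_eq_zero.1 (by omega), Finset.card_eq_zero.1 (by omega)⟩
      have h2 : (1 : ℝ) ≤ (deficient d 2 G).card + (criticalPairs d G).card := by
        exact_mod_cast h1
      have h3 : ((deficient d 2 G).card + (criticalPairs d G).card : ℝ) =
          remDeficiency d n r * (remFrac d 2 r G + remCritical d r G) := by
        have : remDeficiency d n r ≠ 0 := by linarith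
        rw [remFrac, frac, remCritical]
        field_simp
      have h4 := mul_le_mul_of_nonneg_right hq2 (add_nonneg hz0 ha0)
      linarith
  rw [mean_const, mean_add, mean_mul_left, mean_add] at h
  simp only [prob, remMean]
  linarith

theorem tendsto_probSaturates (hd : 2 ≤ d) :
    Tendsto (fun n => probSaturates d n) atTop (𝓝 1) := by
  have hle : ∀ n, probSaturates d n ≤ 1 := fun n => by
    rw [probSaturates, PMF.toOuterMeasure_apply, ← (final d n).tsum_coe]
    exact ENNReal.tsum_le_tsum fun G => Set.indicator_le_self _ _ G
  rw [← ENNReal.tendsto_toReal_iff (fun n => ne_top_of_le_ne_top ENNReal.one_ne_top (hle n))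
    ENNReal.one_ne_top, ENNReal.toReal_one]
  set r := 16 * 2 ^ (d - 2) * d ^ 2 with hr
  have hP1 : 1 ≤ 2 ^ (d - 2) := Nat.one_le_two_pow
  have h1 : Tendsto (fun n => 1 - 3 * (r : ℝ) * (remMean d n r (remFrac d 2 r) +
      remMean d n r (remCritical d r))) atTop (𝓝 1) := by
    have := (((tendsto_remMean_remFrac hd hr.ge).add
      (tendsto_remMean_remCritical hd hr.ge)).const_mul (3 * (r : ℝ))).const_sub 1
    simpa using this
  refine tendsto_of_tendsto_of_tendsto_of_le_of_le h1 tendsto_const_nhds (fun n => ?_) fun n => ?_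
  · refine (one_sub_le_prob_isGood hd (by nlinarith)).trans ?_
    refine (prob_isGood_mono d n (Nat.sub_le _ r)).trans ?_
    exact prob_isGood_le_toReal d n
  · exact ENNReal.toReal_mono ENNReal.one_ne_top (hle n)

end

end RandomDGraph

theorem theorem1p1 (d : ℕ) (hd : 2 ≤ d) :
    Tendsto (fun n : ℕ => RandomDGraph.probSaturates d n) atTop (𝓝 1) :=
  RandomDGraph.tendsto_probSaturates hd
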